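/- Consider the one-dimensional heat equation $\partial_t u-\partial_{xx}u=0$ on $(0,1)$ with Dirichlet boundary conditions $u(\cdot,0)=u(\cdot,1)=0$ and initial datum $u(0,\cdot)=u_0\in L^2(0,1)$; its solutions on $[0,T]$ are understood in $C^0([0,T],L^2(0,1))\cap L^2((0,T),H^1_0(0,1))$. For $T>0$, an open set $E\subset(0,1)$ and a point $x_0\in(0,1)$, define the observability constants $$C(T,E)=\inf\Big\{\Big(\int_0^T\!\!\int_E u(t,x)^2\,dx\,dt\Big)^{1/2}:\ u \text{ a solution with } \|u(T,\cdot)\|_{L^2(0,1)}=1\Big\},$$ $$C(T,x_0)=\inf\Big\{\Big(\int_0^T u(t,x_0)^2\,dt\Big)^{1/2}:\ u \text{ a solution with } \|u(T,\cdot)\|_{L^2(0,1)}=1\Big\}.$$ The heat equation is called pointwise observable at $x_0$ in time $T$ if $C(T,x_0)>0$, and $T_0=T_0(x_0)\in[0,+\infty]$ denotes the minimal time of pointwise observability at $x_0$, i.e. the infimum of all $T>0$ such that the heat equation is pointwise observable at $x_0$ in time $T$ ($T_0=+\infty$ if there is no such $T$). **Theorem.** Fix $x_0\in(0,1)$ and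 $T>0$, and write $C(T,\varepsilon)=C(T,(x_0-\varepsilon,x_0+\varepsilon))$ for $\varepsilon>0$ with $(x_0-\varepsilon,x_0+\varepsilon)\subset(0,1)$. 1. If $T>T_0$, then there exist constants $C_1,C_2>0$ (depending on $x_0$ and $T$) such that $C_1\varepsilon^{1/2}\le C(T,\varepsilon)\le C_2\varepsilon^{1/2}$ for every $\varepsilon>0$ with $(x_0-\varepsilon,x_0+\varepsilon)\subset(0,1)$. 2. If $T<T_0$, then there exist a sequence $\varepsilon_k\to0$ with $\varepsilon_k>0$ and $(x_0-\varepsilon_k,x_0+\varepsilon_k)\subset(0,1)$ for all $k$, and constants $C_1>0$ and $C_2>1/2$ (depending on $x_0$ and $T$), such that $C(T,\varepsilon_k)\le C_1\varepsilon_k^{C_2}$ for all $k$. -/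

import Mathlib

open MeasureTheory Filter Topology
open scoped ENNReal

namespace HeatObs

/-- Lebesgue measure on the interval `(0, 1)`. -/
noncomputable def unitMeasure : Measure ℝ := volume.restrict (Set.Ioo (0 : ℝ) 1)

/-- `v` is (the continuous representative of) an element of `H₀¹(0,1)` with weak derivative `g`:
`g ∈ L²(0,1)`, `v` is the primitive of `g` on `[0,1]` vanishing at `0`, and `v` vanishes at `1`. -/
structure IsH10 (v g : ℝ → ℝ) : Prop where
  memLp_deriv : MemLp g 2 unitMeasure
  eq_primitive : ∀ x ∈ Set.Icc (0 : ℝ) 1, v x = ∫ y in (0 : ℝ)..x, g y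
  right_zero : v 1 = 0

/-- `u` (as a function of time and space) is a solution on `[0,T] × (0,1)` of the heat equation
`∂ₜu - ∂ₓₓu = 0` with Dirichlet boundary conditions and initial datum `u₀ ∈ L²(0,1)`, in the class
`C⁰([0,T], L²(0,1)) ∩ L²((0,T), H₀¹(0,1))`. The equation is taken in the variational sense
`d/dt ∫ u φ = - ∫ ∂ₓu φ'` for all `φ ∈ H₀¹(0,1)`, integrated in time. For almost every `t`, the
values `u t x`, `x ∈ [0,1]`, are those of the continuous representative of `u t ∈ H₀¹(0,1)`. -/
structure IsHeatSolution (T : ℝ) (u₀ : ℝ → ℝ) (u : ℝ → ℝ → ℝ) : Prop where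
  memLp_initial : MemLp u₀ 2 unitMeasure
  initial : u 0 =ᵐ[unitMeasure] u₀
  memLp : ∀ t ∈ Set.Icc (0 : ℝ) T, MemLp (u t) 2 unitMeasure
  continuous_L2 : ∀ t ∈ Set.Icc (0 : ℝ) T,
    Tendsto (fun s => eLpNorm (fun x => u s x - u t x) 2 unitMeasure)
      (𝓝[Set.Icc (0 : ℝ) T] t) (𝓝 0)
  equation : ∃ w : ℝ → ℝ → ℝ,
    MemLp (Function.uncurry w) 2 ((volume.restrict (Set.Ioo (0 : ℝ) T)).prod unitMeasure) ∧
    (∀ᵐ t ∂(volume.restrict (Set.Ioo (0 : ℝ) T)), IsH10 (u t) (w t)) ∧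
    ∀ φ ψ : ℝ → ℝ, IsH10 φ ψ → ∀ t ∈ Set.Icc (0 : ℝ) T,
      (∫ x in (0 : ℝ)..1, u t x * φ x) - (∫ x in (0 : ℝ)..1, u₀ x * φ x) =
        -∫ s in (0 : ℝ)..t, ∫ x in (0 : ℝ)..1, w s x * ψ x

/-- The observability constant `C(T,E)` on `E ⊆ (0,1)` in time `T`: the infimum of
`(∫₀ᵀ ∫_E u(t,x)² dx dt)^(1/2)` over the solutions `u` of the heat equation
with `‖u(T)‖_{L²(0,1)} = 1`. -/
noncomputable def obsConst (T : ℝ) (E : Set ℝ) : ℝ≥0∞ :=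
  ⨅ (u₀ : ℝ → ℝ) (u : ℝ → ℝ → ℝ) (_ : IsHeatSolution T u₀ u)
    (_ : eLpNorm (u T) 2 unitMeasure = 1),
    (∫⁻ t in Set.Ioo (0 : ℝ) T, ∫⁻ x in E, ‖u t x‖ₑ ^ 2) ^ (1 / 2 : ℝ)

/-- The observability constant `C(T,x₀)` at the point `x₀` in time `T`: the infimum of
`(∫₀ᵀ u(t,x₀)² dt)^(1/2)` over the solutions `u` of the heat equation
with `‖u(T)‖_{L²(0,1)} = 1`. -/
noncomputable def pointObsConst (T x₀ : ℝ) : ℝ≥0∞ :=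
  ⨅ (u₀ : ℝ → ℝ) (u : ℝ → ℝ → ℝ) (_ : IsHeatSolution T u₀ u)
    (_ : eLpNorm (u T) 2 unitMeasure = 1),
    (∫⁻ t in Set.Ioo (0 : ℝ) T, ‖u t x₀‖ₑ ^ 2) ^ (1 / 2 : ℝ)

/-- The heat equation is pointwise observable at `x₀` in time `T`. -/
def PointwiseObservable (T x₀ : ℝ) : Prop := 0 < pointObsConst T x₀

/-- The minimal time `T₀ ∈ [0,+∞]` of pointwise observability at `x₀`: the infimum of the times in
which the heat equation is pointwise observable at `x₀` (`+∞` if there is no such time). -/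
noncomputable def minimalTime (x₀ : ℝ) : ℝ≥0∞ :=
  ⨅ (T : ℝ) (_ : 0 < T) (_ : PointwiseObservable T x₀), ENNReal.ofReal T

end HeatObs

namespace HeatObs

/-! Everything is read off the sine series: the coefficients of a solution are multiplied by `e^{-λₙ
t}`, so at a fixed point a solution is an exponential series in time with coefficients proportional
to `sin((n+1)πx₀)`.

For `T > T₀`, observability at `x₀` in some time `T' < T` is a quadratic inequality, on finite sums
of modes, between the final norm at `T'` and the trace at `x₀`. It applies to any coefficients, so
`bₙ` may be replaced by `bₙ sin((n+1)πx) / sin((n+1)πx₀)`: the trace at `x₀` becomes the trace at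
`x`. Integrating over `|x - x₀| < ε` and using that the integral of `sin²` is at least `ε/2` times
its value at the centre, uniformly in the frequency, gives the lower bound of order `ε^{1/2}`
(`PointwiseObservable.exists_le_obsConst`); truncation extends it to all solutions. The upper bound
comes from the first eigenmode.

For `T < S < T' < T₀`, observability fails in time `T'`. This forces `|sin((n+1)πx₀)| ≤ e^{-λₙ S}`
for infinitely many `n` (`frequently_abs_sineMode_le`). With `ε = e^{-λₙ S}` such a mode is `O(√λₙ
ε)` on the whole `ε`-neighbourhood, and normalising it at time `T` costs `e^{λₙ T} = ε^{-T/S}`. The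
observation is therefore `O(ε^{3/2 - T/S})`, with exponent above `1/2` because `T < S`.

The hard ingredient is the converse criterion: if the modes at `x₀` are bounded below by `κ e^{-λₙ
S}`, observability holds in every time beyond `S`. It needs each coefficient of an exponential
series to be controlled by the norm on `(0,τ)` with a loss subexponential in `λₙ`. On `(0,∞)` this
is a Blaschke product estimate; compactness and analyticity pass to `(0,τ)`. -/

/-! ### Eigenvalues, and Gram matrices of exponentials on `(0,∞)`. -/

/-- The `n`-th Dirichlet eigenvalue `((n+1)π)²` of `-∂ₓₓ` on `(0,1)`. -/
noncomputable def eigenvalue (n : ℕ) : ℝ := ((n + 1) * Real.pi) ^ 2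

lemma eigenvalue_pos (n : ℕ) : 0 < eigenvalue n := by
  unfold eigenvalue; positivity

lemma one_le_eigenvalue (n : ℕ) : 1 ≤ eigenvalue n := by
  have h1 : (1 : ℝ) ≤ (n + 1) * Real.pi := by
    have := Real.pi_gt_three
    have hn : (0 : ℝ) ≤ n := n.cast_nonneg
    nlinarith
  unfold eigenvalue
  nlinarith

lemma sq_le_eigenvalue (n : ℕ) : ((n : ℝ) + 1) ^ 2 ≤ eigenvalue n := by
  unfold eigenvalue
  rw [mul_pow]
  have := Real.pi_gt_three
  have h : (1 : ℝ) ≤ Real.pi ^ 2 := by nlinarith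
  nlinarith [sq_nonneg ((n : ℝ) + 1)]

/-- The sums are squared norms in `L²(0,∞)` of `∑ cᵢ e^{-aᵢ t}`. Multiplying `cᵢ` by the Blaschke
factor `(aᵢ - μ)/(aᵢ + μ)` is a contraction, since the difference of the two sides is the square `2μ
(∑ cᵢ/(aᵢ + μ))²`. -/
lemma gram_blaschke_le {ι : Type*} (s : Finset ι) (a c : ι → ℝ) (ha : ∀ i ∈ s, 0 < a i)
    {μ : ℝ} (hμ : 0 < μ) :
    ∑ i ∈ s, ∑ j ∈ s, (c i * ((a i - μ) / (a i + μ))) * (c j * ((a j - μ) / (a j + μ)))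
        / (a i + a j) ≤
      ∑ i ∈ s, ∑ j ∈ s, c i * c j / (a i + a j) := by
  have key : ∑ i ∈ s, ∑ j ∈ s, c i * c j / (a i + a j) -
      ∑ i ∈ s, ∑ j ∈ s, (c i * ((a i - μ) / (a i + μ))) * (c j * ((a j - μ) / (a j + μ)))
        / (a i + a j) = 2 * μ * (∑ i ∈ s, c i / (a i + μ)) ^ 2 := by
    rw [sq, Finset.sum_mul_sum, Finset.mul_sum, ← Finset.sum_sub_distrib]
    refine Finset.sum_congr rfl fun i hi => ?_
    rw [← Finset.sum_sub_distrib, Finset.mul_sum]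
    refine Finset.sum_congr rfl fun j hj => ?_
    have hi' := ha i hi
    have hj' := ha j hj
    have h1 : a i + a j ≠ 0 := by positivity
    have h2 : a i + μ ≠ 0 := by positivity
    have h3 : a j + μ ≠ 0 := by positivity
    field_simp
    ring
  nlinarith [sq_nonneg (∑ i ∈ s, c i / (a i + μ))]

/-- Blaschke factors vanishing at the other exponents remove them one at a time without increasing
the norm. What remains is a multiple of `e^{-aₙ t}`, whose squared norm carries the factor
`1/(2aₙ)`. -/
lemma sq_coeff_le_gram {ι : Type*} [DecidableEq ι] (n : ι) (a : ι → ℝ) (hn : 0 < a n)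
    (t : Finset ι) (hnt : n ∉ t) (ha : ∀ i ∈ t, 0 < a i) (c : ι → ℝ) :
    (c n * ∏ m ∈ t, (a n - a m) / (a n + a m)) ^ 2 / (2 * a n) ≤
      ∑ i ∈ insert n t, ∑ j ∈ insert n t, c i * c j / (a i + a j) := by
  induction t using Finset.induction_on generalizing c with
  | empty => simp; rw [sq, two_mul]
  | insert m t hm ih =>
    have hmn : m ≠ n := fun h => hnt (h ▸ Finset.mem_insert_self m t)
    have ham := ha m (Finset.mem_insert_self m t)
    have hnt' : n ∉ t := fun h => hnt (Finset.mem_insert_of_mem h)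
    have h1 := ih hnt' (fun i hi => ha i (Finset.mem_insert_of_mem hi))
      (fun i => c i * ((a i - a m) / (a i + a m)))
    have h2 := gram_blaschke_le (insert n (insert m t)) a c (by
      intro i hi
      rcases Finset.mem_insert.1 hi with rfl | hi
      · exact hn
      · exact ha i hi) ham
    refine le_trans ?_ (h1.trans (le_trans (le_of_eq ?_) h2))
    · rw [Finset.prod_insert hm]
      simp only [mul_assoc]; exact le_rfl
    · have hm' : m ∉ insert n t := by simp [hmn, hm]
      rw [Finset.insert_comm, Finset.sum_insert hm']
      -- The new factor vanishes at `m`, so the row and column of index `m` disappear.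
      have hz : (c m * ((a m - a m) / (a m + a m))) = 0 := by simp
      simp only [hz, zero_mul, zero_div, Finset.sum_const_zero, zero_add]
      refine Finset.sum_congr rfl fun i _ => ?_
      rw [Finset.sum_insert hm', hz]
      simp

/-! ### Subexponential lower bound for the Blaschke products. -/

/-- The two-sided series `∑ |k|^(-3/2)`. -/
noncomputable def gapConst : ℝ := ∑' k : ℤ, |(k : ℝ)| ^ (-(3 / 2) : ℝ)

/-- The inverse of the factor is at most `1 + 2x²/(d(x+y))` with `x = n+1`, `y = m+1`, `d = |x-y|`.
Bounding `x + y` below by `√(dx)` trades growth in `n` for summability in `m`: the exponent `-3/2`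
is summable over the gaps, and `n^{3/2}` is still `o(λₙ)`. -/
lemma exp_neg_le_abs_blaschke (n m : ℕ) (h : m ≠ n) :
    Real.exp (-(2 * ((n : ℝ) + 1) ^ (3 / 2 : ℝ) * |(((m : ℤ) - n : ℤ) : ℝ)| ^ (-(3 / 2) : ℝ))) ≤
      |(eigenvalue n - eigenvalue m) / (eigenvalue n + eigenvalue m)| := by
  set x : ℝ := (n : ℝ) + 1 with hx
  set y : ℝ := (m : ℝ) + 1 with hy
  have hx0 : 1 ≤ x := by simp [hx]
  have hy0 : 1 ≤ y := by simp [hy]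
  have hd : |(((m : ℤ) - n : ℤ) : ℝ)| = |x - y| := by
    push_cast; rw [abs_sub_comm]; congr 1; simp [hx, hy]
  have hd1 : 1 ≤ |x - y| := by
    rw [← hd, ← Int.cast_abs]
    have h1 : (1 : ℤ) ≤ |(m : ℤ) - n| := Int.one_le_abs (sub_ne_zero.2 (by exact_mod_cast h))
    calc (1 : ℝ) = ((1 : ℤ) : ℝ) := by simp
      _ ≤ _ := Int.cast_le.2 h1
  rw [hd]
  have hr : |(eigenvalue n - eigenvalue m) / (eigenvalue n + eigenvalue m)| =
      |x - y| * (x + y) / (x ^ 2 + y ^ 2) := by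
    have : (eigenvalue n - eigenvalue m) / (eigenvalue n + eigenvalue m) =
      (x - y) * (x + y) / (x ^ 2 + y ^ 2) := by
      unfold eigenvalue
      rw [← hx, ← hy]
      have := Real.pi_pos
      field_simp
      ring
    rw [this, abs_div, abs_mul, abs_of_pos (by positivity : 0 < x + y),
      abs_of_pos (by positivity : 0 < x ^ 2 + y ^ 2)]
  rw [hr, Real.exp_neg, inv_le_comm₀ (Real.exp_pos _) (by positivity), inv_div]
  set d := |x - y| with hdd
  have hdpos : 0 < d := by linarith
  have e1 : (x ^ 2 + y ^ 2) / (d * (x + y)) ≤ 2 * x ^ 2 / (d * (x + y)) + 1 := by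
    rw [div_add_one (by positivity), div_le_div_iff_of_pos_right (by positivity)]
    have : y ^ 2 - x ^ 2 ≤ d * (x + y) := by
      have := neg_abs_le (x - y)
      nlinarith
    linarith
  refine (e1.trans ?_).trans (Real.add_one_le_exp _)
  gcongr
  have hdxy : d ≤ x + y := abs_le.2 ⟨by linarith, by linarith⟩
  -- Both `d` and `x` are at most `x + y`.
  have hs : d ^ (1 / 2 : ℝ) * x ^ (1 / 2 : ℝ) ≤ x + y := by
    calc d ^ (1 / 2 : ℝ) * x ^ (1 / 2 : ℝ) ≤ (x + y) ^ (1 / 2 : ℝ) * (x + y) ^ (1 / 2 : ℝ) := by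
          gcongr; linarith
      _ = x + y := by rw [← Real.rpow_add (by positivity)]; norm_num
  rw [div_le_iff₀ (by positivity)]
  have e2 : x ^ (3 / 2 : ℝ) * x ^ (1 / 2 : ℝ) = x ^ 2 := by
    rw [← Real.rpow_add (by positivity)]; norm_num
  have e3 : d ^ (-(3 / 2) : ℝ) * (d * d ^ (1 / 2 : ℝ)) = 1 := by
    nth_rewrite 2 [← Real.rpow_one d]
    rw [← Real.rpow_add hdpos, ← Real.rpow_add hdpos]; norm_num
  calc 2 * x ^ 2 = 2 * x ^ (3 / 2 : ℝ) * d ^ (-(3 / 2) : ℝ) * (d * (d ^ (1 / 2 : ℝ) *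
        x ^ (1 / 2 : ℝ))) := by
        linear_combination (-2) * e2 - 2 * x ^ (3 / 2 : ℝ) * x ^ (1 / 2 : ℝ) * e3
    _ ≤ _ := by gcongr

lemma summable_gap : Summable fun k : ℤ => |(k : ℝ)| ^ (-(3 / 2) : ℝ) :=
  Real.summable_abs_int_rpow (by norm_num)

lemma sum_gap_le (n : ℕ) (t : Finset ℕ) :
    ∑ m ∈ t, |(((m : ℤ) - n : ℤ) : ℝ)| ^ (-(3 / 2) : ℝ) ≤ gapConst := by
  have hinj : Function.Injective fun m : ℕ => (m : ℤ) - n := by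
    intro a b h; simpa using h
  have := summable_gap.sum_le_tsum (t.map ⟨_, hinj⟩) (fun i _ => by positivity)
  simpa [Finset.sum_map, gapConst] using this

/-- Growth of the biorthogonal family to `(e^{-λₙ t})` in `L²(0,∞)`. -/
noncomputable def growth (n : ℕ) : ℝ :=
  2 * eigenvalue n * Real.exp (4 * gapConst * ((n : ℝ) + 1) ^ (3 / 2 : ℝ))

lemma growth_pos (n : ℕ) : 0 < growth n := by
  unfold growth; have := eigenvalue_pos n; positivity

lemma sq_coeff_le_growth_mul_gram (s : Finset ℕ) (c : ℕ → ℝ) {n : ℕ} (hn : n ∈ s) :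
    c n ^ 2 ≤ growth n *
      ∑ i ∈ s, ∑ j ∈ s, c i * c j / (eigenvalue i + eigenvalue j) := by
  have h := sq_coeff_le_gram n eigenvalue (eigenvalue_pos n) (s.erase n) (by simp)
    (fun i _ => eigenvalue_pos i) c
  rw [Finset.insert_erase hn] at h
  set p := ∏ m ∈ s.erase n, (eigenvalue n - eigenvalue m) / (eigenvalue n + eigenvalue m)
  set E := 2 * gapConst * ((n : ℝ) + 1) ^ (3 / 2 : ℝ) with hE
  have hp : Real.exp (-E) ≤ |p| := by
    rw [Finset.abs_prod]
    calc Real.exp (-E) ≤ Real.exp (∑ m ∈ s.erase n, -(2 * ((n : ℝ) + 1) ^ (3 / 2 : ℝ) *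
          |(((m : ℤ) - n : ℤ) : ℝ)| ^ (-(3 / 2) : ℝ))) := by
          rw [Finset.sum_neg_distrib, ← Finset.mul_sum]
          gcongr
          have := sum_gap_le n (s.erase n)
          rw [hE, mul_assoc, mul_assoc, mul_comm gapConst]
          gcongr
      _ = ∏ m ∈ s.erase n, Real.exp (-(2 * ((n : ℝ) + 1) ^ (3 / 2 : ℝ) *
          |(((m : ℤ) - n : ℤ) : ℝ)| ^ (-(3 / 2) : ℝ))) := Real.exp_sum _ _
      _ ≤ _ := Finset.prod_le_prod (fun _ _ => (Real.exp_pos _).le) fun m hm =>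
          exp_neg_le_abs_blaschke n m (Finset.ne_of_mem_erase hm)
  have hp2 : Real.exp (-(2 * E)) ≤ p ^ 2 := by
    rw [← sq_abs, show -(2 * E) = -E + -E by ring, Real.exp_add, ← sq]
    gcongr
  have hlam := eigenvalue_pos n
  rw [div_le_iff₀ (by positivity), mul_pow] at h
  have hg : growth n = 2 * eigenvalue n * Real.exp (2 * E) := by
    unfold growth; rw [hE]; ring_nf
  have he : Real.exp (2 * E) * Real.exp (-(2 * E)) = 1 := by rw [← Real.exp_add]; simp
  calc c n ^ 2 = Real.exp (2 * E) * (c n ^ 2 * Real.exp (-(2 * E))) := by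
        linear_combination (-c n ^ 2) * he
    _ ≤ Real.exp (2 * E) * (c n ^ 2 * p ^ 2) := by gcongr
    _ ≤ Real.exp (2 * E) * ((∑ i ∈ s, ∑ j ∈ s, c i * c j / (eigenvalue i + eigenvalue j)) *
        (2 * eigenvalue n)) := by gcongr
    _ = _ := by rw [hg]; ring

/-- `λₙ` grows like `n²`, so it dominates the exponent `n^{3/2}` and the polynomial prefactor with
arbitrarily small constant. -/
lemma exists_growth_le_exp {δ : ℝ} (hδ : 0 < δ) :
    ∃ C, 0 < C ∧ ∀ n, growth n ≤ C * Real.exp (δ * eigenvalue n) := by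
  have h0 : 0 ≤ gapConst := tsum_nonneg fun k => by positivity
  have key : ∃ B : ℝ, ∀ x : ℝ, 1 ≤ x → 4 * gapConst * x ^ (3 / 2 : ℝ) ≤ B + δ / 2 * x ^ 2 := by
    -- Above the threshold `√x = 8 gapConst / δ` the left side is at most `(δ/2) x²`; below it the
    -- constant `B` suffices.
    refine ⟨4 * gapConst * (8 * gapConst / δ) ^ (3 : ℝ), fun x hx => ?_⟩
    by_cases hcase : x ^ (1 / 2 : ℝ) ≤ 8 * gapConst / δ
    · have : x ^ (3 / 2 : ℝ) ≤ (8 * gapConst / δ) ^ (3 : ℝ) := by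
        have e : x ^ (3 / 2 : ℝ) = (x ^ (1 / 2 : ℝ)) ^ (3 : ℝ) := by
          rw [← Real.rpow_mul (by positivity)]; norm_num
        rw [e]; gcongr
      have h2 : 4 * gapConst * x ^ (3 / 2 : ℝ) ≤ 4 * gapConst * (8 * gapConst / δ) ^ (3 : ℝ) := by
        gcongr
      nlinarith [sq_nonneg x]
    · push Not at hcase
      rw [div_lt_iff₀ hδ] at hcase
      have e2 : x ^ (3 / 2 : ℝ) * x ^ (1 / 2 : ℝ) = x ^ 2 := by
        rw [← Real.rpow_add (by positivity)]; norm_num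
      have h3 : 0 < x ^ (3 / 2 : ℝ) := by positivity
      have h4 : 0 ≤ 4 * gapConst * (8 * gapConst / δ) ^ (3 : ℝ) := by positivity
      nlinarith
  obtain ⟨B, hB⟩ := key
  refine ⟨2 * (2 / δ) * Real.exp B, by positivity, fun n => ?_⟩
  have hlam := eigenvalue_pos n
  have h1 : eigenvalue n ≤ 2 / δ * Real.exp (δ / 2 * eigenvalue n) := by
    have := Real.add_one_le_exp (δ / 2 * eigenvalue n)
    rw [div_mul_eq_mul_div, le_div_iff₀ hδ]
    linarith
  have h2 : Real.exp (4 * gapConst * ((n : ℝ) + 1) ^ (3 / 2 : ℝ)) ≤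
      Real.exp B * Real.exp (δ / 2 * eigenvalue n) := by
    rw [← Real.exp_add]
    gcongr
    have := hB (n + 1) (by simp)
    have := sq_le_eigenvalue n
    nlinarith
  calc growth n ≤ 2 * (2 / δ * Real.exp (δ / 2 * eigenvalue n)) *
        (Real.exp B * Real.exp (δ / 2 * eigenvalue n)) := by
        unfold growth; gcongr
    _ = 2 * (2 / δ) * Real.exp B * (Real.exp (δ / 2 * eigenvalue n) *
        Real.exp (δ / 2 * eigenvalue n)) := by ring
    _ = _ := by rw [← Real.exp_add]; ring_nf

lemma summable_exp_neg_mul_eigenvalue {δ : ℝ} (hδ : 0 < δ) :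
    Summable fun n => Real.exp (-(δ * eigenvalue n)) := by
  have : Summable fun n : ℕ => Real.exp (n * (-δ)) := Real.summable_exp_nat_mul_iff.2 (by linarith)
  refine this.of_nonneg_of_le (fun n => (Real.exp_pos _).le) fun n => ?_
  gcongr
  have := sq_le_eigenvalue n
  have hn : (n : ℝ) ≤ eigenvalue n := by nlinarith [n.cast_nonneg (α := ℝ)]
  nlinarith [mul_le_mul_of_nonneg_left hn hδ.le]

lemma summable_growth_mul_exp {δ : ℝ} (hδ : 0 < δ) :
    Summable fun n => growth n * Real.exp (-(δ * eigenvalue n)) := by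
  obtain ⟨C, -, hC⟩ := exists_growth_le_exp (half_pos hδ)
  refine ((summable_exp_neg_mul_eigenvalue (half_pos hδ)).mul_left C).of_nonneg_of_le
    (fun n => by have := growth_pos n; positivity) fun n => ?_
  calc growth n * Real.exp (-(δ * eigenvalue n)) ≤
      C * Real.exp (δ / 2 * eigenvalue n) * Real.exp (-(δ * eigenvalue n)) := by
        gcongr; exact hC n
    _ = _ := by rw [mul_assoc, ← Real.exp_add]; ring_nf

/-! ### Exponential series: from `L²(0,∞)` to `L²(0,τ)`. -/

lemma abs_le_one_add_sq (x : ℝ) : |x| ≤ 1 + x ^ 2 := by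
  rw [← sq_abs]; nlinarith [sq_nonneg (|x| - 1), abs_nonneg x]

lemma continuous_expSum (s : Finset ℕ) (c : ℕ → ℝ) :
    Continuous fun t => ∑ n ∈ s, c n * Real.exp (-(eigenvalue n * t)) := by fun_prop

lemma integral_Ioi_sq_expSum (s : Finset ℕ) (c : ℕ → ℝ) :
    IntegrableOn (fun t => (∑ n ∈ s, c n * Real.exp (-(eigenvalue n * t))) ^ 2) (Set.Ioi 0) ∧
    ∫ t in Set.Ioi (0 : ℝ), (∑ n ∈ s, c n * Real.exp (-(eigenvalue n * t))) ^ 2 =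
      ∑ i ∈ s, ∑ j ∈ s, c i * c j / (eigenvalue i + eigenvalue j) := by
  have hexp : ∀ t, (∑ n ∈ s, c n * Real.exp (-(eigenvalue n * t))) ^ 2 =
      ∑ i ∈ s, ∑ j ∈ s, c i * c j * Real.exp (-(eigenvalue i + eigenvalue j) * t) := by
    intro t
    rw [sq, Finset.sum_mul_sum]
    refine Finset.sum_congr rfl fun i _ => Finset.sum_congr rfl fun j _ => ?_
    rw [show -(eigenvalue i + eigenvalue j) * t = -(eigenvalue i * t) + -(eigenvalue j * t) by ring,
      Real.exp_add]
    ring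
  have hneg : ∀ i j, -(eigenvalue i + eigenvalue j) < 0 := fun i j => by
    have := eigenvalue_pos i; have := eigenvalue_pos j; linarith
  have hint : ∀ i j, IntegrableOn
      (fun t => c i * c j * Real.exp (-(eigenvalue i + eigenvalue j) * t)) (Set.Ioi 0) :=
    fun i j => (integrableOn_exp_mul_Ioi (hneg i j) 0).const_mul _
  simp_rw [hexp]
  refine ⟨integrable_finsetSum _ fun i _ => integrable_finsetSum _ fun j _ => hint i j, ?_⟩
  rw [integral_finsetSum _ fun i _ => integrable_finsetSum _ fun j _ => hint i j]
  refine Finset.sum_congr rfl fun i _ => ?_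
  rw [integral_finsetSum _ fun j _ => hint i j]
  refine Finset.sum_congr rfl fun j _ => ?_
  rw [integral_const_mul, integral_exp_mul_Ioi (hneg i j)]
  rw [mul_zero, Real.exp_zero, neg_div_neg_eq, mul_one_div]

lemma summable_one_add_growth_mul_exp {δ : ℝ} (hδ : 0 < δ) :
    Summable fun n => (1 + growth n) * Real.exp (-(δ * eigenvalue n)) := by
  simpa [add_mul] using (summable_exp_neg_mul_eigenvalue hδ).add (summable_growth_mul_exp hδ)

/-- One half of the exponent gives summability in `n`, the other, by `λₙ ≥ 1`, integrability in `t`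
at infinity. -/
lemma exp_neg_eigenvalue_mul_le (n : ℕ) {σ t : ℝ} (hσ : 0 < σ) (ht : σ < t) :
    Real.exp (-(eigenvalue n * t)) ≤
      Real.exp (-(σ / 2 * eigenvalue n)) * Real.exp (-(t / 2)) := by
  rw [← Real.exp_add]
  gcongr
  nlinarith [one_le_eigenvalue n]

lemma norm_coeff_mul_exp_le {c : ℕ → ℝ} (hc : ∀ n, |c n| ≤ 1 + growth n) (n : ℕ) {σ t : ℝ}
    (hσ : 0 < σ) (ht : σ < t) :
    ‖c n * Real.exp (-(eigenvalue n * t))‖ ≤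
      (1 + growth n) * Real.exp (-(σ / 2 * eigenvalue n)) * Real.exp (-(t / 2)) := by
  rw [norm_mul, Real.norm_eq_abs, Real.norm_eq_abs, Real.abs_exp, mul_assoc]
  have := growth_pos n
  gcongr
  · exact hc n
  · exact exp_neg_eigenvalue_mul_le n hσ ht

/-- An exponential series vanishing on an interval vanishes identically. -/
lemma expSeries_eq_zero {c : ℕ → ℝ} (hc : ∀ n, |c n| ≤ 1 + growth n) {σ τ : ℝ} (hσ : 0 < σ)
    (hστ : σ < τ)
    (h0 : ∀ t ∈ Set.Ioo σ τ, ∑' n, c n * Real.exp (-(eigenvalue n * t)) = 0) :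
    ∀ t, σ < t → ∑' n, c n * Real.exp (-(eigenvalue n * t)) = 0 := by
  -- The series extends holomorphically to the half-plane `Re z > σ`, where the identity theorem
  -- applies.
  set G : ℂ → ℂ := fun z => ∑' n, (c n : ℂ) * Complex.exp (-((eigenvalue n : ℂ) * z)) with hG
  have hGF : ∀ t : ℝ, G t = ((∑' n, c n * Real.exp (-(eigenvalue n * t)) : ℝ) : ℂ) := by
    intro t
    simp [hG, Complex.ofReal_tsum]
  set U : Set ℂ := {z | σ < z.re} with hU
  have hUo : IsOpen U := isOpen_lt continuous_const Complex.continuous_re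
  have hdiff : DifferentiableOn ℂ G U := by
    refine Complex.differentiableOn_tsum_of_summable_norm
      (summable_one_add_growth_mul_exp (half_pos hσ)) (fun n => ?_) hUo fun n z hz => ?_
    · exact Differentiable.differentiableOn (by fun_prop)
    · have h1 := norm_coeff_mul_exp_le hc n hσ (show σ < z.re from hz)
      have h2 : Real.exp (-(z.re / 2)) ≤ 1 := by
        rw [Real.exp_le_one_iff]
        have : σ < z.re := hz
        linarith
      have hg := growth_pos n
      calc ‖(c n : ℂ) * Complex.exp (-((eigenvalue n : ℂ) * z))‖
          = ‖c n * Real.exp (-(eigenvalue n * z.re))‖ := by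
            simp [Complex.norm_exp]
        _ ≤ _ := h1
        _ ≤ (1 + growth n) * Real.exp (-(σ / 2 * eigenvalue n)) * 1 := by gcongr
        _ = _ := mul_one _
  have hpre : IsPreconnected U := (convex_halfSpace_re_gt σ).isPreconnected
  set x := (σ + τ) / 2 with hx
  have hxm : x ∈ Set.Ioo σ τ := ⟨by linarith, by linarith⟩
  have hfreq : ∃ᶠ z in 𝓝[≠] (x : ℂ), G z = 0 := by
    have ht : Tendsto (fun t : ℝ => (t : ℂ)) (𝓝[≠] x) (𝓝[≠] (x : ℂ)) := by
      refine tendsto_nhdsWithin_iff.2 ⟨Complex.continuous_ofReal.continuousAt.tendsto.mono_left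
        nhdsWithin_le_nhds, ?_⟩
      filter_upwards [self_mem_nhdsWithin] with t ht
      simpa using ht
    refine ht.frequently (Eventually.frequently ?_)
    filter_upwards [nhdsWithin_le_nhds (Ioo_mem_nhds hxm.1 hxm.2)] with t ht
    rw [hGF, h0 t ht]; simp
  have hz := (hdiff.analyticOnNhd hUo).eqOn_zero_of_preconnected_of_frequently_eq_zero hpre
    (show (x : ℂ) ∈ U by simpa [hU] using hxm.1) hfreq
  intro t ht
  have := hz (show (t : ℂ) ∈ U by simpa [hU] using ht)
  rw [hGF] at this
  simpa using this

/-- On Dirichlet polynomials with exponents `λₙ` the norm of `L²(0,∞)` is controlled by that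
of `L²(0,τ)`. -/
theorem exists_gram_le_integral {τ : ℝ} (hτ : 0 < τ) :
    ∃ C, 0 < C ∧ ∀ (s : Finset ℕ) (c : ℕ → ℝ),
      ∑ i ∈ s, ∑ j ∈ s, c i * c j / (eigenvalue i + eigenvalue j) ≤
        C * ∫ t in (0 : ℝ)..τ, (∑ n ∈ s, c n * Real.exp (-(eigenvalue n * t))) ^ 2 := by
  -- Compactness: take polynomials of norm one on `(0,∞)` whose mass on `(0,τ)` tends to zero. Their
  -- coefficients stay in a product of compact intervals, so a subsequence converges termwise. The
  -- limit series vanishes on `(τ/2,τ)`, hence on `(τ/2,∞)` by analyticity, and all the mass is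
  -- lost.
  by_contra! hcon
  have hnorm : ∀ k : ℕ, ∃ (s : Finset ℕ) (d : ℕ → ℝ), (∀ n, n ∉ s → d n = 0) ∧
      ∑ i ∈ s, ∑ j ∈ s, d i * d j / (eigenvalue i + eigenvalue j) = 1 ∧
      ∫ t in (0 : ℝ)..τ, (∑ n ∈ s, d n * Real.exp (-(eigenvalue n * t))) ^ 2 ≤
        1 / ((k : ℝ) + 1) := by
    intro k
    obtain ⟨s, c, h⟩ := hcon (k + 1) (by positivity)
    set Q := ∑ i ∈ s, ∑ j ∈ s, c i * c j / (eigenvalue i + eigenvalue j)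
    have hI : 0 ≤ ∫ t in (0 : ℝ)..τ, (∑ n ∈ s, c n * Real.exp (-(eigenvalue n * t))) ^ 2 :=
      intervalIntegral.integral_nonneg hτ.le fun _ _ => sq_nonneg _
    have hQ : 0 < Q := lt_of_le_of_lt (by positivity) h
    have hQs : Real.sqrt Q ^ 2 = Q := Real.sq_sqrt hQ.le
    have hQinv : Q⁻¹ = (Real.sqrt Q)⁻¹ ^ 2 := by rw [inv_pow, hQs]
    -- Zero outside `s`, so that the sums over varying index sets become series over `ℕ` and the
    -- coefficients can converge pointwise.
    refine ⟨s, fun n => if n ∈ s then c n / Real.sqrt Q else 0, fun n hn => if_neg hn, ?_, ?_⟩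
    · calc _ = ∑ i ∈ s, ∑ j ∈ s, c i * c j / (eigenvalue i + eigenvalue j) * Q⁻¹ := by
            refine Finset.sum_congr rfl fun i hi => Finset.sum_congr rfl fun j hj => ?_
            dsimp only
            rw [if_pos hi, if_pos hj, hQinv]
            ring
        _ = 1 := by
            simp_rw [← Finset.sum_mul]
            exact mul_inv_cancel₀ hQ.ne'
    · have : ∀ t, (∑ n ∈ s, (if n ∈ s then c n / Real.sqrt Q else 0) *
          Real.exp (-(eigenvalue n * t))) ^ 2 =
          Q⁻¹ * (∑ n ∈ s, c n * Real.exp (-(eigenvalue n * t))) ^ 2 := by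
        intro t
        rw [hQinv, ← mul_pow, Finset.mul_sum]
        congr 1
        refine Finset.sum_congr rfl fun i hi => ?_
        rw [if_pos hi]; ring
      simp_rw [this]
      rw [intervalIntegral.integral_const_mul, inv_mul_le_iff₀ hQ, mul_one_div,
        le_div_iff₀ (by positivity), mul_comm]
      exact h.le
  choose s d hsupp hgram hsmall using hnorm
  have hbound : ∀ k n, |d k n| ≤ 1 + growth n := by
    intro k n
    have hg := growth_pos n
    by_cases hn : n ∈ s k
    · have := sq_coeff_le_growth_mul_gram (s k) (d k) hn
      rw [hgram, mul_one] at this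
      linarith [abs_le_one_add_sq (d k n)]
    · rw [hsupp k n hn]; simp; linarith
  have hcpt : IsCompact (Set.univ.pi fun n => Set.Icc (-(1 + growth n)) (1 + growth n)) :=
    isCompact_univ_pi fun n => isCompact_Icc
  obtain ⟨c, hcmem, φ, hφ, hlim⟩ := hcpt.tendsto_subseq (x := d)
    fun k n _ => abs_le.1 (hbound k n)
  have hc : ∀ n, |c n| ≤ 1 + growth n := fun n => abs_le.2 (hcmem n trivial)
  have hlim' : ∀ n, Tendsto (fun k => d (φ k) n) atTop (𝓝 (c n)) := fun n =>
    (tendsto_pi_nhds.1 hlim) n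
  set f : ℕ → ℝ → ℝ := fun k t => ∑ n ∈ s k, d k n * Real.exp (-(eigenvalue n * t)) with hf
  have hfc : ∀ k, Continuous (f k) := fun k => continuous_expSum _ _
  have hft : ∀ k t, f k t = ∑' n, d k n * Real.exp (-(eigenvalue n * t)) := by
    intro k t
    rw [tsum_eq_sum (s := s k)]
    intro n hn
    rw [hsupp k n hn, zero_mul]
  set F : ℝ → ℝ := fun t => ∑' n, c n * Real.exp (-(eigenvalue n * t)) with hF
  -- Away from `t = 0` the factors `e^{-λₙ t}` beat `growth`, giving a common dominating function;
  -- the mass on `(0,σ]` is already small.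
  set σ := τ / 2 with hσd
  have hσ : 0 < σ := half_pos hτ
  have hστ : σ < τ := half_lt_self hτ
  set D := ∑' n, (1 + growth n) * Real.exp (-(σ / 2 * eigenvalue n)) with hD
  have hsum := summable_one_add_growth_mul_exp (half_pos hσ)
  have hptw : ∀ t, σ < t → Tendsto (fun k => f (φ k) t) atTop (𝓝 (F t)) := by
    intro t ht
    simp_rw [hft]
    refine tendsto_tsum_of_dominated_convergence (hsum.mul_right (Real.exp (-(t / 2))))
      (fun n => (hlim' n).mul_const _) (Eventually.of_forall fun k n => ?_)
    exact norm_coeff_mul_exp_le (hbound _) n hσ ht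
  have hdom : ∀ k t, σ < t → ‖f k t ^ 2‖ ≤ D ^ 2 * Real.exp (-1 * t) := by
    intro k t ht
    have h1 : ‖f k t‖ ≤ D * Real.exp (-(t / 2)) := by
      rw [hft, hD, ← tsum_mul_right]
      exact tsum_of_norm_bounded (hsum.mul_right _).hasSum
        fun n => norm_coeff_mul_exp_le (hbound k) n hσ ht
    rw [norm_pow]
    calc ‖f k t‖ ^ 2 ≤ (D * Real.exp (-(t / 2))) ^ 2 := by gcongr
      _ = _ := by
        rw [mul_pow, sq (Real.exp _), ← Real.exp_add]; ring_nf
  have hexpi : IntegrableOn (fun t => D ^ 2 * Real.exp (-1 * t)) (Set.Ioi σ) :=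
    Integrable.const_mul (integrableOn_exp_mul_Ioi (by norm_num) σ) _
  have hconv : ∀ S : Set ℝ, MeasurableSet S → S ⊆ Set.Ioi σ →
      Tendsto (fun k => ∫ t in S, f (φ k) t ^ 2) atTop (𝓝 (∫ t in S, F t ^ 2)) := by
    intro S hS hSσ
    refine tendsto_integral_of_dominated_convergence (fun t => D ^ 2 * Real.exp (-1 * t))
      (fun k => ((hfc _).pow 2).aestronglyMeasurable)
      (hexpi.mono_set hSσ) (fun k => ?_) ?_
    · filter_upwards [ae_restrict_mem hS] with t ht using hdom _ t (hSσ ht)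
    · filter_upwards [ae_restrict_mem hS] with t ht using (hptw t (hSσ ht)).pow 2
  have hint : ∀ k, IntegrableOn (fun t => f k t ^ 2) (Set.Ioi 0) := fun k =>
    (integral_Ioi_sq_expSum (s k) (d k)).1
  have hsm : ∀ S : Set ℝ, MeasurableSet S → S ⊆ Set.Ioc 0 τ →
      Tendsto (fun k => ∫ t in S, f (φ k) t ^ 2) atTop (𝓝 0) := by
    intro S hS hSτ
    refine squeeze_zero (fun k => integral_nonneg fun _ => sq_nonneg _) (fun k => ?_)
      (tendsto_one_div_add_atTop_nhds_zero_nat.comp hφ.tendsto_atTop)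
    refine le_trans ?_ (hsmall (φ k))
    rw [intervalIntegral.integral_of_le hτ.le]
    exact setIntegral_mono_set ((hint _).mono_set Set.Ioc_subset_Ioi_self)
      (Eventually.of_forall fun _ => sq_nonneg _) hSτ.eventuallyLE
  have hFcont : ContinuousOn F (Set.Ioi σ) := by
    refine continuousOn_tsum (u := fun n => (1 + growth n) * Real.exp (-(σ / 2 * eigenvalue n)))
      (fun n => by fun_prop) hsum fun n t ht => ?_
    refine (norm_coeff_mul_exp_le hc n hσ ht).trans ?_
    have h2 : Real.exp (-(t / 2)) ≤ 1 := by
      rw [Real.exp_le_one_iff]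
      have : σ < t := ht
      linarith
    have := growth_pos n
    exact mul_le_of_le_one_right (by positivity) h2
  have hFdom : ∀ t, σ < t → ‖F t ^ 2‖ ≤ D ^ 2 * Real.exp (-1 * t) := fun t ht =>
    le_of_tendsto ((hptw t ht).pow 2).norm (Eventually.of_forall fun k => hdom _ t ht)
  have hFzero : ∀ t ∈ Set.Ioo σ τ, F t = 0 := by
    have hI : ∫ t in Set.Ioo σ τ, F t ^ 2 = 0 :=
      tendsto_nhds_unique (hconv _ measurableSet_Ioo fun t ht => ht.1)
        (hsm _ measurableSet_Ioo fun t ht => ⟨hσ.trans ht.1, ht.2.le⟩)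
    have hFi : IntegrableOn (fun t => F t ^ 2) (Set.Ioo σ τ) := by
      refine (hexpi.mono_set fun t ht => ht.1).mono'
        (((hFcont.mono fun t ht => ht.1).pow 2).aestronglyMeasurable measurableSet_Ioo) ?_
      filter_upwards [ae_restrict_mem measurableSet_Ioo] with t ht using hFdom t ht.1
    have hae := (integral_eq_zero_iff_of_nonneg_ae
      (Eventually.of_forall fun _ => sq_nonneg _) hFi).1 hI
    have := Measure.eqOn_open_of_ae_eq hae isOpen_Ioo
      ((hFcont.mono fun t ht => ht.1).pow 2) continuousOn_const
    intro t ht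
    simpa using this ht
  have hFall := expSeries_eq_zero hc hσ hστ hFzero
  have h1 := hconv (Set.Ioi σ) measurableSet_Ioi subset_rfl
  have h2 := hsm (Set.Ioc 0 σ) measurableSet_Ioc (Set.Ioc_subset_Ioc_right hστ.le)
  have h3 : ∫ t in Set.Ioi σ, F t ^ 2 = 0 := by
    rw [setIntegral_congr_fun (g := fun _ => 0) measurableSet_Ioi fun t ht => by
      simp [hF, hFall t ht]]
    simp
  rw [h3] at h1
  have h4 : ∀ k, (∫ t in Set.Ioc 0 σ, f k t ^ 2) + ∫ t in Set.Ioi σ, f k t ^ 2 = 1 := by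
    intro k
    rw [← setIntegral_union (Set.Ioc_disjoint_Ioi le_rfl) measurableSet_Ioi
      ((hint k).mono_set Set.Ioc_subset_Ioi_self) ((hint k).mono_set (Set.Ioi_subset_Ioi hσ.le)),
      Set.Ioc_union_Ioi_eq_Ioi hσ.le, ← hgram k]
    exact (integral_Ioi_sq_expSum (s k) (d k)).2
  have h5 := h2.add h1
  simp only [h4] at h5
  have := tendsto_nhds_unique h5 tendsto_const_nhds
  norm_num at this

/-- Coefficients of an exponential series are controlled by its norm in `L²(0,τ)`. -/
theorem exists_sq_coeff_le_integral {τ : ℝ} (hτ : 0 < τ) :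
    ∃ C, 0 < C ∧ ∀ c : ℕ → ℝ, Summable (fun n => |c n|) → ∀ n,
      c n ^ 2 ≤ C * growth n *
        ∫ t in (0 : ℝ)..τ, (∑' n, c n * Real.exp (-(eigenvalue n * t))) ^ 2 := by
  obtain ⟨C, hC, h⟩ := exists_gram_le_integral hτ
  refine ⟨C, hC, fun c hc n => ?_⟩
  have hb : ∀ t, 0 ≤ t → ∀ m, ‖c m * Real.exp (-(eigenvalue m * t))‖ ≤ |c m| := by
    intro t ht m
    rw [norm_mul, Real.norm_eq_abs, Real.norm_eq_abs, Real.abs_exp]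
    refine mul_le_of_le_one_right (abs_nonneg _) ?_
    rw [Real.exp_le_one_iff]
    have := eigenvalue_pos m
    have : 0 ≤ eigenvalue m * t := by positivity
    linarith
  have hlim : Tendsto (fun N => ∫ t in (0 : ℝ)..τ,
      (∑ m ∈ Finset.range N, c m * Real.exp (-(eigenvalue m * t))) ^ 2) atTop
      (𝓝 (∫ t in (0 : ℝ)..τ, (∑' n, c n * Real.exp (-(eigenvalue n * t))) ^ 2)) := by
    refine intervalIntegral.tendsto_integral_filter_of_dominated_convergence
      (fun _ => (∑' n, |c n|) ^ 2) (Eventually.of_forall fun N =>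
        ((continuous_expSum _ _).pow 2).aestronglyMeasurable)
      (Eventually.of_forall fun N => Eventually.of_forall fun t ht => ?_)
      (by simp) (Eventually.of_forall fun t ht => ?_)
    · rw [Set.uIoc_of_le hτ.le] at ht
      rw [norm_pow]
      gcongr
      refine (norm_sum_le _ _).trans ((Finset.sum_le_sum fun m _ => hb t ht.1.le m).trans ?_)
      exact hc.sum_le_tsum _ fun _ _ => abs_nonneg _
    · rw [Set.uIoc_of_le hτ.le] at ht
      exact ((Summable.of_norm_bounded hc (hb t ht.1.le)).hasSum.tendsto_sum_nat).pow 2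
  -- The estimate for partial sums passes to the limit because `C * growth n` does not depend on
  -- their length.
  refine ge_of_tendsto (hlim.const_mul (C * growth n)) ?_
  filter_upwards [eventually_gt_atTop n] with N hN
  have h1 := sq_coeff_le_growth_mul_gram (Finset.range N) c (Finset.mem_range.2 hN)
  have h2 := h (Finset.range N) c
  have := growth_pos n
  calc c n ^ 2 ≤ _ := h1
    _ ≤ growth n * (C * ∫ t in (0 : ℝ)..τ,
      (∑ m ∈ Finset.range N, c m * Real.exp (-(eigenvalue m * t))) ^ 2) := by gcongr
    _ = _ := by ring

/-! ### Sine series on `(0,1)` and Parseval's identity. -/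

/-- The `n`-th Dirichlet eigenfunction `sin ((n+1)πx)`. -/
noncomputable def sineMode (n : ℕ) (x : ℝ) : ℝ := Real.sin ((n + 1) * Real.pi * x)

/-- The sine coefficients of a function on `(0,1)`. -/
noncomputable def sineCoeff (v : ℝ → ℝ) (n : ℕ) : ℝ := ∫ x in (0 : ℝ)..1, v x * sineMode n x

@[fun_prop]
lemma continuous_sineMode (n : ℕ) : Continuous (sineMode n) := by
  unfold sineMode; fun_prop

lemma abs_sineMode_le_one (n : ℕ) (x : ℝ) : |sineMode n x| ≤ 1 := Real.abs_sin_le_one _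

lemma hasDerivAt_sineMode (n : ℕ) (x : ℝ) :
    HasDerivAt (sineMode n) ((n + 1) * Real.pi * Real.cos ((n + 1) * Real.pi * x)) x :=
  (((hasDerivAt_id' x).const_mul (((n : ℝ) + 1) * Real.pi)).sin).congr_deriv (by ring)

lemma hasDerivAt_cosMode (n : ℕ) (x : ℝ) :
    HasDerivAt (fun x => (n + 1) * Real.pi * Real.cos ((n + 1) * Real.pi * x))
      (-(eigenvalue n * sineMode n x)) x := by
  refine ((((hasDerivAt_id' x).const_mul (((n : ℝ) + 1) * Real.pi)).cos).const_mul
    (((n : ℝ) + 1) * Real.pi)).congr_deriv ?_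
  unfold sineMode eigenvalue
  ring

instance : IsFiniteMeasure unitMeasure := by
  unfold unitMeasure; infer_instance

lemma unitMeasure_eq_Ioc : unitMeasure = volume.restrict (Set.Ioc (0 : ℝ) 1) :=
  Measure.restrict_congr_set Ioo_ae_eq_Ioc

lemma unitMeasure_univ : unitMeasure Set.univ = 1 := by
  simp [unitMeasure]

lemma memLp_unitMeasure_of_continuous {v : ℝ → ℝ} (hv : ContinuousOn v (Set.Icc 0 1)) :
    MemLp v 2 unitMeasure := by
  obtain ⟨C, hC⟩ := isCompact_Icc.exists_bound_of_continuousOn hv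
  refine MemLp.of_bound
    ((hv.mono Set.Ioo_subset_Icc_self).aestronglyMeasurable measurableSet_Ioo) C ?_
  filter_upwards [ae_restrict_mem measurableSet_Ioo] with x hx using hC x ⟨hx.1.le, hx.2.le⟩

lemma intervalIntegrable_of_memLp {v : ℝ → ℝ} (hv : MemLp v 2 unitMeasure) :
    IntervalIntegrable v volume 0 1 := by
  rw [intervalIntegrable_iff_integrableOn_Ioc_of_le zero_le_one]
  rw [unitMeasure_eq_Ioc] at hv
  exact hv.integrable (by norm_num)

lemma intervalIntegrable_mul_of_memLp {v g : ℝ → ℝ} (hv : MemLp v 2 unitMeasure)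
    (hg : Continuous g) : IntervalIntegrable (fun x => v x * g x) volume 0 1 :=
  (intervalIntegrable_of_memLp hv).mul_continuousOn hg.continuousOn

/-- The odd extension of a function on `(0,1)`. -/
noncomputable def oddExtension (v : ℝ → ℝ) : ℝ → ℝ :=
  (Set.Ioi (0 : ℝ)).piecewise v fun x => -v (-x)

lemma memLp_oddExtension {v : ℝ → ℝ} (hv : MemLp v 2 unitMeasure) :
    MemLp (oddExtension v) 2 (volume.restrict (Set.Ioc (-1 : ℝ) 1)) := by
  rw [unitMeasure_eq_Ioc] at hv
  refine MemLp.piecewise measurableSet_Ioi ?_ ?_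
  · rw [Measure.restrict_restrict measurableSet_Ioi]
    refine hv.mono_measure (Measure.restrict_mono ?_ le_rfl)
    intro x hx
    exact ⟨hx.1, hx.2.2⟩
  · rw [Measure.restrict_restrict measurableSet_Ioi.compl]
    have h1 : MemLp v 2 (volume.restrict (Set.Icc (0 : ℝ) 1)) := by
      rwa [Measure.restrict_congr_set Ioc_ae_eq_Icc] at hv
    have h2 := h1.comp_measurePreserving
      ((Measure.measurePreserving_neg (volume : Measure ℝ)).restrict_preimage
        (measurableSet_Icc (a := (0 : ℝ)) (b := 1)))
    refine h2.neg.mono_measure (Measure.restrict_mono ?_ le_rfl)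
    intro x hx
    have h3 : x ≤ 0 := by simpa using hx.1
    exact ⟨by simpa using h3, by linarith [hx.2.1]⟩

/-- Folding `(-1,0)` onto `(0,1)` leaves only the odd part of the exponential. Completeness of the
sines is thereby inherited from Fourier series of period 2. -/
lemma fourierCoeffOn_oddExtension {v : ℝ → ℝ} (hv : MemLp v 2 unitMeasure) (n : ℤ) :
    fourierCoeffOn (by norm_num : (-1 : ℝ) < 1) (fun x => (oddExtension v x : ℂ)) n =
      -Complex.I * ((∫ x in (0 : ℝ)..1, v x * Real.sin (n * Real.pi * x) : ℝ) : ℂ) := by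
  have hV : IntervalIntegrable (fun x => (oddExtension v x : ℂ)) volume (-1) 1 := by
    rw [intervalIntegrable_iff_integrableOn_Ioc_of_le (by norm_num)]
    exact ((memLp_oddExtension hv).integrable (by norm_num)).ofReal
  set e : ℝ → ℂ := fun x => Complex.exp (-(n * Real.pi * x * Complex.I)) with he
  have hec : Continuous e := by fun_prop
  have hint : IntervalIntegrable (fun x => e x * (oddExtension v x : ℂ)) volume (-1) 1 :=
    hV.continuousOn_mul hec.continuousOn
  have hi1 : IntervalIntegrable (fun x => e x * (oddExtension v x : ℂ)) volume (-1) 0 :=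
    hint.mono_set (by
      rw [Set.uIcc_of_le (by norm_num), Set.uIcc_of_le (by norm_num)]
      exact Set.Icc_subset_Icc_right (by norm_num))
  have hi2 : IntervalIntegrable (fun x => e x * (oddExtension v x : ℂ)) volume 0 1 :=
    hint.mono_set (by
      rw [Set.uIcc_of_le (by norm_num), Set.uIcc_of_le (by norm_num)]
      exact Set.Icc_subset_Icc_left (by norm_num))
  have hvi := (intervalIntegrable_of_memLp hv)
  have hvc : IntervalIntegrable (fun x => (v x : ℂ)) volume 0 1 := by
    rw [intervalIntegrable_iff_integrableOn_Ioc_of_le zero_le_one] at hvi ⊢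
    exact hvi.ofReal
  rw [fourierCoeffOn_eq_integral]
  have h1 : ∫ x in (-1 : ℝ)..1, fourier (-n) (x : AddCircle ((1 : ℝ) - -1)) •
      (oddExtension v x : ℂ) = ∫ x in (-1 : ℝ)..1, e x * (oddExtension v x : ℂ) := by
    refine intervalIntegral.integral_congr fun x _ => ?_
    simp only [smul_eq_mul, fourier_coe_apply, he]
    congr 2
    push_cast
    ring
  rw [h1, ← intervalIntegral.integral_add_adjacent_intervals hi1 hi2]
  have h2 : ∫ x in (-1 : ℝ)..0, e x * (oddExtension v x : ℂ) =
      ∫ x in (0 : ℝ)..1, -(e (-x) * (v x : ℂ)) := by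
    rw [← neg_zero, ← intervalIntegral.integral_comp_neg, neg_zero]
    refine intervalIntegral.integral_congr_ae (Eventually.of_forall fun x hx => ?_)
    rw [Set.uIoc_of_le zero_le_one] at hx
    have hx' : -x ∉ Set.Ioi (0 : ℝ) := by simp; exact hx.1.le
    simp [oddExtension, Set.piecewise_eq_of_notMem _ _ _ hx']
  have h3 : ∫ x in (0 : ℝ)..1, e x * (oddExtension v x : ℂ) =
      ∫ x in (0 : ℝ)..1, e x * (v x : ℂ) := by
    refine intervalIntegral.integral_congr_ae (Eventually.of_forall fun x hx => ?_)
    rw [Set.uIoc_of_le zero_le_one] at hx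
    have hx' : x ∈ Set.Ioi (0 : ℝ) := hx.1
    simp [oddExtension, Set.piecewise_eq_of_mem _ _ _ hx']
  have hj1 : IntervalIntegrable (fun x => -(e (-x) * (v x : ℂ))) volume 0 1 :=
    (hvc.continuousOn_mul (hec.comp continuous_neg).continuousOn).neg
  rw [h2, h3, ← intervalIntegral.integral_add hj1 (hvc.continuousOn_mul hec.continuousOn),
    ← intervalIntegral.integral_ofReal,
    ← intervalIntegral.integral_const_mul, ← intervalIntegral.integral_smul]
  refine intervalIntegral.integral_congr fun x _ => ?_
  have hs : e x - e (-x) = -(2 * Complex.I * Complex.sin (n * Real.pi * x)) := by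
    rw [Complex.sin]
    simp only [he, Complex.ofReal_neg, mul_neg, neg_mul, neg_neg]
    linear_combination (Complex.exp (-(n * Real.pi * x * Complex.I)) -
      Complex.exp (n * Real.pi * x * Complex.I)) * Complex.I_sq
  simp only [Complex.real_smul]
  push_cast
  linear_combination (v x / 2 : ℂ) * hs

/-- Parseval's identity for sine series on `(0,1)`. -/
theorem hasSum_sq_sineCoeff {v : ℝ → ℝ} (hv : MemLp v 2 unitMeasure) :
    HasSum (fun n => 2 * sineCoeff v n ^ 2) (∫ x in (0 : ℝ)..1, v x ^ 2) := by
  have hL := memLp_oddExtension hv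
  have h := hasSum_sq_fourierCoeffOn (by norm_num : (-1 : ℝ) < 1)
    (f := fun x => (oddExtension v x : ℂ)) hL.ofReal
  simp_rw [fourierCoeffOn_oddExtension hv] at h
  set S : ℤ → ℝ := fun k => ∫ x in (0 : ℝ)..1, v x * Real.sin (k * Real.pi * x) with hS
  have hSn : ∀ k, ‖-Complex.I * (S k : ℂ)‖ ^ 2 = S k ^ 2 := fun k => by simp
  have hsq : IntervalIntegrable (fun x => oddExtension v x ^ 2) volume (-1) 1 := by
    rw [intervalIntegrable_iff_integrableOn_Ioc_of_le (by norm_num)]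
    exact hL.integrable_sq
  have hi1 := hsq.mono_set (c := -1) (d := 0) (by
      rw [Set.uIcc_of_le (by norm_num), Set.uIcc_of_le (by norm_num)]
      exact Set.Icc_subset_Icc_right (by norm_num))
  have hi2 := hsq.mono_set (c := 0) (d := 1) (by
      rw [Set.uIcc_of_le (by norm_num), Set.uIcc_of_le (by norm_num)]
      exact Set.Icc_subset_Icc_left (by norm_num))
  have hval : ((1 : ℝ) - -1)⁻¹ • ∫ x in (-1 : ℝ)..1, ‖(oddExtension v x : ℂ)‖ ^ 2 =
      ∫ x in (0 : ℝ)..1, v x ^ 2 := by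
    simp only [Complex.norm_real, Real.norm_eq_abs, sq_abs]
    rw [← intervalIntegral.integral_add_adjacent_intervals hi1 hi2]
    have h2 : ∫ x in (-1 : ℝ)..0, oddExtension v x ^ 2 = ∫ x in (0 : ℝ)..1, v x ^ 2 := by
      rw [← neg_zero, ← intervalIntegral.integral_comp_neg, neg_zero]
      refine intervalIntegral.integral_congr_ae (Eventually.of_forall fun x hx => ?_)
      rw [Set.uIoc_of_le zero_le_one] at hx
      have hx' : -x ∉ Set.Ioi (0 : ℝ) := by simp; exact hx.1.le
      simp [oddExtension, Set.piecewise_eq_of_notMem _ _ _ hx']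
    have h3 : ∫ x in (0 : ℝ)..1, oddExtension v x ^ 2 = ∫ x in (0 : ℝ)..1, v x ^ 2 := by
      refine intervalIntegral.integral_congr_ae (Eventually.of_forall fun x hx => ?_)
      rw [Set.uIoc_of_le zero_le_one] at hx
      have hx' : x ∈ Set.Ioi (0 : ℝ) := hx.1
      simp [oddExtension, Set.piecewise_eq_of_mem _ _ _ hx']
    rw [h2, h3, smul_eq_mul]; ring
  rw [hval] at h
  change HasSum (fun k => ‖-Complex.I * (S k : ℂ)‖ ^ 2) _ at h
  simp_rw [hSn] at h
  have h0 : S 0 = 0 := by simp [hS]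
  have h1 : ∀ n : ℕ, S ((n + 1 : ℕ) : ℤ) = sineCoeff v n := fun n => by
    simp only [hS, sineCoeff, sineMode]; push_cast; rfl
  have h2 : ∀ k, S (-k) = -S k := fun k => by
    simp only [hS]
    rw [← intervalIntegral.integral_neg]
    refine intervalIntegral.integral_congr fun x _ => ?_
    rw [Int.cast_neg, neg_mul, neg_mul, Real.sin_neg]; ring
  have h' := h.nat_add_neg
  -- The frequencies `k` and `-k` are paired, giving the factor 2; frequency 0 contributes nothing,
  -- and the shift by one matches `sineMode n` with frequency `n+1`.
  rw [← hasSum_nat_add_iff' 1] at h'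
  simp only [h1, h2, neg_sq, Finset.range_one, Finset.sum_singleton, Nat.cast_zero, h0] at h'
  simpa [← two_mul] using h'

lemma ae_eq_zero_of_sineCoeff {v : ℝ → ℝ} (hv : MemLp v 2 unitMeasure)
    (h : ∀ n, sineCoeff v n = 0) : v =ᵐ[unitMeasure] 0 := by
  have h1 := hasSum_sq_sineCoeff hv
  simp only [h] at h1
  have h2 : ∫ x in (0 : ℝ)..1, v x ^ 2 = 0 := by
    refine h1.unique ?_
    simp
  rw [intervalIntegral.integral_of_le zero_le_one, ← unitMeasure_eq_Ioc] at h2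
  have h3 := (integral_eq_zero_iff_of_nonneg (fun _ => sq_nonneg _) hv.integrable_sq).1 h2
  filter_upwards [h3] with x hx
  simpa using hx

lemma integral_cos_int_mul_pi {k : ℤ} (hk : k ≠ 0) :
    ∫ x in (0 : ℝ)..1, Real.cos (k * Real.pi * x) = 0 := by
  have hk' : (k : ℝ) * Real.pi ≠ 0 := by
    have := Real.pi_ne_zero
    have : (k : ℝ) ≠ 0 := by exact_mod_cast hk
    positivity
  rw [intervalIntegral.integral_comp_mul_left _ hk']
  simp [Real.sin_int_mul_pi]

lemma sineCoeff_sineMode (m n : ℕ) :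
    sineCoeff (sineMode m) n = if m = n then 1 / 2 else 0 := by
  have hprod : ∀ x, sineMode m x * sineMode n x =
      (Real.cos (((m : ℤ) - n : ℤ) * Real.pi * x) -
        Real.cos (((m : ℤ) + n + 2 : ℤ) * Real.pi * x)) / 2 := by
    intro x
    have h1 : (((m : ℤ) - n : ℤ) : ℝ) * Real.pi * x =
        (m + 1) * Real.pi * x - (n + 1) * Real.pi * x := by push_cast; ring
    have h2 : (((m : ℤ) + n + 2 : ℤ) : ℝ) * Real.pi * x =
        (m + 1) * Real.pi * x + (n + 1) * Real.pi * x := by push_cast; ring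
    rw [h1, h2, Real.cos_sub, Real.cos_add]
    unfold sineMode; ring
  unfold sineCoeff
  simp_rw [hprod]
  rw [intervalIntegral.integral_div, intervalIntegral.integral_sub
    (Continuous.intervalIntegrable (by fun_prop) _ _)
    (Continuous.intervalIntegrable (by fun_prop) _ _),
    integral_cos_int_mul_pi (k := (m : ℤ) + n + 2) (by omega)]
  split_ifs with h
  · simp [h]
  · rw [integral_cos_int_mul_pi (by omega)]; simp

lemma sineCoeff_sub {v w : ℝ → ℝ} (hv : MemLp v 2 unitMeasure) (hw : MemLp w 2 unitMeasure)
    (n : ℕ) : sineCoeff (fun x => v x - w x) n = sineCoeff v n - sineCoeff w n := by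
  unfold sineCoeff
  simp_rw [sub_mul]
  exact intervalIntegral.integral_sub
    (intervalIntegrable_mul_of_memLp hv (by fun_prop))
    (intervalIntegrable_mul_of_memLp hw (by fun_prop))

lemma sineCoeff_finset_sum (s : Finset ℕ) (b : ℕ → ℝ) (n : ℕ) :
    sineCoeff (fun x => ∑ m ∈ s, b m * sineMode m x) n = if n ∈ s then b n / 2 else 0 := by
  have h : ∀ m, ∫ x in (0 : ℝ)..1, b m * sineMode m x * sineMode n x =
      b m * (if m = n then 1 / 2 else 0) := by
    intro m
    rw [← sineCoeff_sineMode, sineCoeff, ← intervalIntegral.integral_const_mul]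
    simp_rw [mul_assoc]
  unfold sineCoeff
  simp_rw [Finset.sum_mul]
  rw [intervalIntegral.integral_finsetSum fun m _ =>
    Continuous.intervalIntegrable (by fun_prop) _ _]
  simp_rw [h]
  simp [div_eq_mul_inv]

lemma sineCoeff_tsum {b : ℕ → ℝ} (hb : Summable fun n => |b n|) (n : ℕ) :
    sineCoeff (fun x => ∑' m, b m * sineMode m x) n = b n / 2 := by
  have hbd : ∀ m x, ‖b m * sineMode m x‖ ≤ |b m| := fun m x => by
    rw [norm_mul, Real.norm_eq_abs]
    exact mul_le_of_le_one_right (abs_nonneg _) (abs_sineMode_le_one m x)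
  have h := intervalIntegral.hasSum_integral_of_dominated_convergence
    (F := fun m x => b m * sineMode m x * sineMode n x)
    (f := fun x => (∑' m, b m * sineMode m x) * sineMode n x) (μ := volume) (a := 0) (b := 1)
    (fun m _ => |b m|)
    (fun m => Continuous.aestronglyMeasurable (by fun_prop))
    (fun m => Eventually.of_forall fun x _ => by
      rw [norm_mul]
      exact (mul_le_of_le_one_right (norm_nonneg _) (abs_sineMode_le_one n x)).trans (hbd m x))
    (Eventually.of_forall fun x _ => hb)
    (by simp)
    (Eventually.of_forall fun x _ =>
      ((Summable.of_norm_bounded hb fun m => hbd m x).hasSum).mul_right _)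
  have h2 : ∀ m, ∫ x in (0 : ℝ)..1, b m * sineMode m x * sineMode n x =
      if m = n then b n / 2 else 0 := by
    intro m
    have : ∫ x in (0 : ℝ)..1, b m * sineMode m x * sineMode n x =
      b m * sineCoeff (sineMode m) n := by
      rw [sineCoeff, ← intervalIntegral.integral_const_mul]
      simp_rw [mul_assoc]
    rw [this, sineCoeff_sineMode]
    split_ifs with hmn
    · rw [hmn]; ring
    · simp
  simp_rw [h2] at h
  exact h.unique (hasSum_ite_eq n (b n / 2))

/-! ### Integration by parts in `H₀¹` and finite sums of modes. -/

lemma IsH10.continuousOn {v g : ℝ → ℝ} (h : IsH10 v g) : ContinuousOn v (Set.Icc 0 1) := by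
  have hi := intervalIntegrable_of_memLp h.memLp_deriv
  have h1 := intervalIntegral.continuousOn_primitive_interval
    ((intervalIntegrable_iff' (by simp)).1 hi)
  rw [Set.uIcc_of_le zero_le_one] at h1
  exact h1.congr h.eq_primitive

lemma IsH10.memLp {v g : ℝ → ℝ} (h : IsH10 v g) : MemLp v 2 unitMeasure :=
  memLp_unitMeasure_of_continuous h.continuousOn

/-- `φ` is only absolutely continuous, so the derivative of its primitive equals `ψ` almost
everywhere; the boundary terms vanish with `φ` at both ends. -/
lemma IsH10.integral_mul_eq {φ ψ g g' : ℝ → ℝ} (h : IsH10 φ ψ)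
    (hg : ∀ x, HasDerivAt g (g' x) x) (hg' : Continuous g') :
    ∫ x in (0 : ℝ)..1, ψ x * g x = -∫ x in (0 : ℝ)..1, φ x * g' x := by
  have hi := intervalIntegrable_of_memLp h.memLp_deriv
  have hderiv : deriv g = g' := funext fun x => (hg x).deriv
  have hgc : ContDiff ℝ 1 g := contDiff_one_iff_deriv.2
    ⟨fun x => (hg x).differentiableAt, hderiv ▸ hg'⟩
  have h1 := AbsolutelyContinuousOnInterval.integral_mul_deriv_eq_deriv_mul
    (hgc.contDiffOn.absolutelyContinuousOnInterval (a := 0) (b := 1))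
    (hi.absolutelyContinuousOnInterval_intervalIntegral (c := 0) (by simp))
  have h0 : φ 1 = ∫ y in (0 : ℝ)..1, ψ y := h.eq_primitive 1 (by simp)
  rw [← h0, h.right_zero, intervalIntegral.integral_same, hderiv] at h1
  have h2 : ∫ x in (0 : ℝ)..1, g x * deriv (fun x => ∫ y in (0 : ℝ)..x, ψ y) x =
      ∫ x in (0 : ℝ)..1, ψ x * g x := by
    refine intervalIntegral.integral_congr_ae ?_
    filter_upwards [hi.ae_hasDerivAt_integral] with x hx hx'
    rw [(hx (Set.uIoc_subset_uIcc hx') 0 (by simp)).deriv, mul_comm]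
  have h3 : ∫ x in (0 : ℝ)..1, g' x * (∫ y in (0 : ℝ)..x, ψ y) =
      ∫ x in (0 : ℝ)..1, φ x * g' x := by
    refine intervalIntegral.integral_congr fun x hx => ?_
    rw [Set.uIcc_of_le zero_le_one] at hx
    rw [h.eq_primitive x hx, mul_comm]
  rw [h2, h3] at h1
  linarith

lemma isH10_sineMode (n : ℕ) :
    IsH10 (sineMode n) fun x => (n + 1) * Real.pi * Real.cos ((n + 1) * Real.pi * x) where
  memLp_deriv := memLp_unitMeasure_of_continuous (Continuous.continuousOn (by fun_prop))
  eq_primitive x _ := by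
    rw [intervalIntegral.integral_eq_sub_of_hasDerivAt (fun y _ => hasDerivAt_sineMode n y)
      (Continuous.intervalIntegrable (by fun_prop) _ _)]
    simp [sineMode]
  right_zero := by
    have := Real.sin_nat_mul_pi (n + 1)
    simpa [sineMode] using this

/-- A finite superposition of separated solutions `e^{-λₙ t} sin ((n+1)πx)`. -/
noncomputable def modeSum (s : Finset ℕ) (b : ℕ → ℝ) (t x : ℝ) : ℝ :=
  ∑ n ∈ s, b n * Real.exp (-(eigenvalue n * t)) * sineMode n x

lemma continuous_uncurry_modeSum (s : Finset ℕ) (b : ℕ → ℝ) :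
    Continuous (Function.uncurry (modeSum s b)) := by
  unfold modeSum Function.uncurry
  fun_prop

lemma continuous_modeSum_right (s : Finset ℕ) (b : ℕ → ℝ) (t : ℝ) :
    Continuous (modeSum s b t) := by
  unfold modeSum
  fun_prop

lemma continuous_modeSum_left (s : Finset ℕ) (b : ℕ → ℝ) (x : ℝ) :
    Continuous fun t => modeSum s b t x := by
  unfold modeSum
  fun_prop

lemma integral_modeSum_mul (s : Finset ℕ) (b : ℕ → ℝ) (t : ℝ) {φ : ℝ → ℝ}
    (hφ : MemLp φ 2 unitMeasure) :
    ∫ x in (0 : ℝ)..1, modeSum s b t x * φ x =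
      ∑ n ∈ s, b n * Real.exp (-(eigenvalue n * t)) * sineCoeff φ n := by
  unfold modeSum sineCoeff
  simp_rw [Finset.sum_mul]
  rw [intervalIntegral.integral_finsetSum fun n _ => ?_]
  · refine Finset.sum_congr rfl fun n _ => ?_
    rw [← intervalIntegral.integral_const_mul]
    refine intervalIntegral.integral_congr fun x _ => ?_
    ring
  · have := intervalIntegrable_mul_of_memLp hφ (g := fun x =>
      b n * Real.exp (-(eigenvalue n * t)) * sineMode n x) (by fun_prop)
    exact this.congr fun x _ => mul_comm _ _

/-- These explicit solutions are the competitors in every upper bound for an infimum. -/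
theorem isHeatSolution_modeSum (T : ℝ) (s : Finset ℕ) (b : ℕ → ℝ) :
    IsHeatSolution T (modeSum s b 0) (modeSum s b) where
  memLp_initial := memLp_unitMeasure_of_continuous (continuous_modeSum_right s b 0).continuousOn
  initial := EventuallyEq.rfl
  memLp t _ := memLp_unitMeasure_of_continuous (continuous_modeSum_right s b t).continuousOn
  continuous_L2 t _ := by
    set r : ℝ → ℝ := fun τ => ∑ n ∈ s, |b n| *
      |Real.exp (-(eigenvalue n * τ)) - Real.exp (-(eigenvalue n * t))| with hr
    have hrc : Continuous r := by fun_prop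
    have hrt : r t = 0 := by simp [hr]
    have hlim : Tendsto (fun τ => ENNReal.ofReal (r τ)) (𝓝[Set.Icc 0 T] t) (𝓝 0) := by
      have := (ENNReal.continuous_ofReal.comp hrc).tendsto t
      simp only [Function.comp_def, hrt, ENNReal.ofReal_zero] at this
      exact this.mono_left nhdsWithin_le_nhds
    refine tendsto_of_tendsto_of_tendsto_of_le_of_le tendsto_const_nhds hlim
      (fun _ => zero_le) fun τ => ?_
    refine (eLpNorm_le_of_ae_bound (C := r τ) (Eventually.of_forall fun x => ?_)).trans ?_
    · simp only [modeSum, ← Finset.sum_sub_distrib]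
      refine (norm_sum_le _ _).trans (Finset.sum_le_sum fun n _ => ?_)
      rw [← sub_mul, ← mul_sub, norm_mul, norm_mul]
      exact mul_le_of_le_one_right (by positivity) (abs_sineMode_le_one n x)
    · simp [unitMeasure_univ]
  equation := by
    set w : ℝ → ℝ → ℝ := fun t x => ∑ n ∈ s, b n * Real.exp (-(eigenvalue n * t)) *
      ((n + 1) * Real.pi * Real.cos ((n + 1) * Real.pi * x)) with hw
    have hwc : Continuous (Function.uncurry w) := by
      unfold w Function.uncurry; fun_prop
    refine ⟨w, ?_, Eventually.of_forall fun t => ?_, ?_⟩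
    · obtain ⟨C, hC⟩ := (isCompact_Icc.prod isCompact_Icc).exists_bound_of_continuousOn
        (hwc.continuousOn (s := Set.Icc 0 T ×ˢ Set.Icc 0 1))
      refine MemLp.of_bound hwc.aestronglyMeasurable C ?_
      rw [unitMeasure, Measure.prod_restrict]
      filter_upwards [ae_restrict_mem (measurableSet_Ioo.prod measurableSet_Ioo)] with p hp
      exact hC p ⟨⟨hp.1.1.le, hp.1.2.le⟩, ⟨hp.2.1.le, hp.2.2.le⟩⟩
    · have hwt : Continuous (w t) := hwc.comp (by fun_prop : Continuous fun x => (t, x))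
      refine ⟨memLp_unitMeasure_of_continuous hwt.continuousOn, fun x _ => ?_, ?_⟩
      · have hd : ∀ y, HasDerivAt (modeSum s b t) (w t y) y := fun y => by
          unfold modeSum w
          exact HasDerivAt.fun_sum fun n _ => (hasDerivAt_sineMode n y).const_mul _
        rw [intervalIntegral.integral_eq_sub_of_hasDerivAt (fun y _ => hd y)
          (hwt.intervalIntegrable _ _)]
        simp [modeSum, sineMode]
      · unfold modeSum
        exact Finset.sum_eq_zero fun n _ => by rw [(isH10_sineMode n).right_zero, mul_zero]
    · intro φ ψ h t _
      rw [integral_modeSum_mul s b t h.memLp, integral_modeSum_mul s b 0 h.memLp]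
      have h1 : ∀ τ, ∫ x in (0 : ℝ)..1, w τ x * ψ x =
          ∑ n ∈ s, b n * sineCoeff φ n * (eigenvalue n * Real.exp (-(eigenvalue n * τ))) := by
        intro τ
        simp only [hw, Finset.sum_mul]
        rw [intervalIntegral.integral_finsetSum fun n _ => ?_]
        · refine Finset.sum_congr rfl fun n _ => ?_
          have h2 := h.integral_mul_eq (hasDerivAt_cosMode n) (by fun_prop)
          have h3 : ∫ x in (0 : ℝ)..1, φ x * -(eigenvalue n * sineMode n x) =
              -(eigenvalue n * sineCoeff φ n) := by
            rw [sineCoeff, ← intervalIntegral.integral_const_mul, ← intervalIntegral.integral_neg]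
            refine intervalIntegral.integral_congr fun x _ => ?_
            ring
          rw [h3, neg_neg] at h2
          calc _ = ∫ x in (0 : ℝ)..1, b n * Real.exp (-(eigenvalue n * τ)) *
                (ψ x * ((n + 1) * Real.pi * Real.cos ((n + 1) * Real.pi * x))) := by
                refine intervalIntegral.integral_congr fun x _ => ?_
                ring
            _ = _ := by
                rw [intervalIntegral.integral_const_mul, h2]; ring
        · have := intervalIntegrable_mul_of_memLp h.memLp_deriv (g := fun x =>
            b n * Real.exp (-(eigenvalue n * τ)) *
            ((n + 1) * Real.pi * Real.cos ((n + 1) * Real.pi * x))) (by fun_prop)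
          exact this.congr fun x _ => mul_comm _ _
      simp_rw [h1]
      rw [intervalIntegral.integral_finsetSum fun n _ =>
        Continuous.intervalIntegrable (by fun_prop) _ _, ← Finset.sum_sub_distrib,
        ← Finset.sum_neg_distrib]
      refine Finset.sum_congr rfl fun n _ => ?_
      have h4 : ∫ τ in (0 : ℝ)..t, eigenvalue n * Real.exp (-(eigenvalue n * τ)) =
          -Real.exp (-(eigenvalue n * t)) - -Real.exp (-(eigenvalue n * 0)) := by
        refine intervalIntegral.integral_eq_sub_of_hasDerivAt
          (f := fun τ => -Real.exp (-(eigenvalue n * τ))) (fun τ _ => ?_)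
          (Continuous.intervalIntegrable (by fun_prop) _ _)
        exact (((hasDerivAt_id' τ).const_mul (eigenvalue n)).fun_neg.exp.fun_neg).congr_deriv (by ring)
      rw [intervalIntegral.integral_const_mul, h4]
      ring

/-! ### Sine expansion of an arbitrary solution. -/

namespace IsHeatSolution

variable {T : ℝ} {u₀ : ℝ → ℝ} {u : ℝ → ℝ → ℝ}

/-- Testing with the `n`-th sine and integrating by parts in space turns the weak equation into the
integral form of `a' = -λₙ a`. This makes `a` continuous, then differentiable, and the integrating
factor `e^{λₙ t}` finishes. -/
theorem sineCoeff_eq (h : IsHeatSolution T u₀ u) (n : ℕ) {t : ℝ} (ht : t ∈ Set.Icc 0 T) :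
    sineCoeff (u t) n = sineCoeff u₀ n * Real.exp (-(eigenvalue n * t)) := by
  obtain ⟨w, hw, hae, heq⟩ := h.equation
  have hT : 0 ≤ T := ht.1.trans ht.2
  set a : ℝ → ℝ := fun t => sineCoeff (u t) n with ha
  set g : ℝ → ℝ := fun x => (n + 1) * Real.pi * Real.cos ((n + 1) * Real.pi * x) with hg
  have hgc : Continuous g := by fun_prop
  set J : ℝ → ℝ := fun τ => ∫ x in (0 : ℝ)..1, w τ x * g x with hJ
  have hJa : ∀ᵐ τ ∂(volume.restrict (Set.Ioc 0 T)), J τ = eigenvalue n * a τ := by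
    rw [← Measure.restrict_congr_set Ioo_ae_eq_Ioc]
    filter_upwards [hae] with τ hτ
    have h2 := hτ.integral_mul_eq (hasDerivAt_cosMode n) (by fun_prop)
    have h3 : ∫ x in (0 : ℝ)..1, u τ x * -(eigenvalue n * sineMode n x) =
        -(eigenvalue n * a τ) := by
      simp only [ha, sineCoeff]
      rw [← intervalIntegral.integral_const_mul, ← intervalIntegral.integral_neg]
      refine intervalIntegral.integral_congr fun x _ => ?_
      ring
    rw [h3, neg_neg] at h2
    exact h2
  have hJi : IntegrableOn J (Set.Ioc 0 T) := by
    rw [IntegrableOn, ← Measure.restrict_congr_set Ioo_ae_eq_Ioc]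
    have hgm : MemLp (fun p : ℝ × ℝ => g p.2) 2
        ((volume.restrict (Set.Ioo (0 : ℝ) T)).prod unitMeasure) := by
      refine MemLp.of_bound (hgc.comp continuous_snd).aestronglyMeasurable ((n + 1) * Real.pi)
        (Eventually.of_forall fun p => ?_)
      have hk : 0 ≤ ((n : ℝ) + 1) * Real.pi := by positivity
      rw [hg, norm_mul, Real.norm_of_nonneg hk]
      exact mul_le_of_le_one_right hk (Real.abs_cos_le_one _)
    have := (hw.integrable_mul hgm).integral_prod_left
    refine this.congr (Eventually.of_forall fun τ => ?_)
    simp only [hJ]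
    rw [intervalIntegral.integral_of_le zero_le_one, ← unitMeasure_eq_Ioc]
    rfl
  have hlam := eigenvalue_pos n
  have hai : IntegrableOn a (Set.Ioc 0 T) := by
    refine (hJi.const_mul (eigenvalue n)⁻¹).congr ?_
    filter_upwards [hJa] with τ hτ
    rw [hτ, inv_mul_cancel_left₀ hlam.ne']
  have hfix : ∀ τ ∈ Set.Icc 0 T, a τ = sineCoeff u₀ n - eigenvalue n * ∫ r in (0 : ℝ)..τ, a r := by
    intro τ hτ
    have h1 := heq _ _ (isH10_sineMode n) τ hτ
    have h2 : ∫ r in (0 : ℝ)..τ, J r = eigenvalue n * ∫ r in (0 : ℝ)..τ, a r := by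
      rw [← intervalIntegral.integral_const_mul]
      refine intervalIntegral.integral_congr_ae ?_
      rw [ae_restrict_iff' measurableSet_Ioc] at hJa
      filter_upwards [hJa] with r hr hr'
      rw [Set.uIoc_of_le hτ.1] at hr'
      exact hr ⟨hr'.1, hr'.2.trans hτ.2⟩
    have h3 : a τ - sineCoeff u₀ n = -∫ r in (0 : ℝ)..τ, J r := h1
    linarith
  have hac : ContinuousOn a (Set.Icc 0 T) := by
    have h1 : ContinuousOn (fun τ => ∫ r in (0 : ℝ)..τ, a r) (Set.uIcc 0 T) := by
      refine intervalIntegral.continuousOn_primitive_interval ?_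
      rwa [Set.uIcc_of_le hT, integrableOn_Icc_iff_integrableOn_Ioc]
    rw [Set.uIcc_of_le hT] at h1
    exact (continuousOn_const.sub (continuousOn_const.mul h1)).congr hfix
  -- A constant continuation of `a` beyond `[0,T]`, so that its primitive has a two-sided derivative
  -- everywhere.
  set B : ℝ → ℝ := fun τ => a (Set.projIcc 0 T hT τ) with hB
  have hBc : Continuous B :=
    (continuousOn_iff_continuous_domRestrict.1 hac).comp continuous_projIcc
  have hBa : ∀ τ ∈ Set.Icc 0 T, B τ = a τ := fun τ hτ => by
    simp only [hB, Set.projIcc_of_mem hT hτ]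
  set G : ℝ → ℝ := fun τ => sineCoeff u₀ n - eigenvalue n * ∫ r in (0 : ℝ)..τ, B r with hG
  have hGd : ∀ τ, HasDerivAt G (-(eigenvalue n * B τ)) τ := fun τ => by
    have := intervalIntegral.integral_hasDerivAt_right (hBc.intervalIntegrable 0 τ)
      (hBc.stronglyMeasurableAtFilter _ _) hBc.continuousAt
    exact ((this.const_mul (eigenvalue n)).const_sub _)
  have hGa : ∀ τ ∈ Set.Icc 0 T, G τ = a τ := fun τ hτ => by
    rw [hfix τ hτ, hG]
    simp only
    rw [intervalIntegral.integral_congr (g := a) fun r hr => ?_]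
    rw [Set.uIcc_of_le hτ.1] at hr
    exact hBa r ⟨hr.1, hr.2.trans hτ.2⟩
  have hHd : ∀ τ, HasDerivAt (fun τ => G τ * Real.exp (eigenvalue n * τ))
      (eigenvalue n * (G τ - B τ) * Real.exp (eigenvalue n * τ)) τ := fun τ =>
    ((hGd τ).mul (((hasDerivAt_id' τ).const_mul (eigenvalue n)).exp)).congr_deriv (by ring)
  have hconst := constant_of_has_deriv_right_zero (a := 0) (b := T)
    (f := fun τ => G τ * Real.exp (eigenvalue n * τ))
    (fun τ _ => (hHd τ).continuousAt.continuousWithinAt) (fun τ hτ => by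
      have hτ' : τ ∈ Set.Icc 0 T := ⟨hτ.1, hτ.2.le⟩
      have := (hHd τ).hasDerivWithinAt (s := Set.Ici τ)
      rwa [hGa τ hτ', hBa τ hτ', sub_self, mul_zero, zero_mul] at this) t ht
  have hG0 : G 0 = sineCoeff u₀ n := by simp [hG]
  simp only [hG0, mul_zero, Real.exp_zero, mul_one] at hconst
  rw [hGa t ht] at hconst
  rw [← hconst, mul_assoc, ← Real.exp_add]
  simp [ha]

lemma summable_sq_sineCoeff (h : IsHeatSolution T u₀ u) :
    Summable fun n => 2 * sineCoeff u₀ n ^ 2 :=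
  (hasSum_sq_sineCoeff h.memLp_initial).summable

lemma hasSum_integral_sq (h : IsHeatSolution T u₀ u) {t : ℝ} (ht : t ∈ Set.Icc 0 T) :
    HasSum (fun n => 2 * sineCoeff u₀ n ^ 2 * Real.exp (-(2 * eigenvalue n * t)))
      (∫ x in (0 : ℝ)..1, u t x ^ 2) := by
  have := hasSum_sq_sineCoeff (h.memLp t ht)
  simp only [h.sineCoeff_eq _ ht] at this
  convert this using 2 with n
  rw [mul_pow, sq (Real.exp _), ← Real.exp_add]
  ring_nf

lemma exists_abs_sineCoeff_le (h : IsHeatSolution T u₀ u) :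
    ∃ M, ∀ n, |sineCoeff u₀ n| ≤ M := by
  refine ⟨1 + ∑' n, 2 * sineCoeff u₀ n ^ 2, fun n => ?_⟩
  have h1 := h.summable_sq_sineCoeff.le_tsum n fun _ _ => by positivity
  have h2 := abs_le_one_add_sq (sineCoeff u₀ n)
  nlinarith [sq_nonneg (sineCoeff u₀ n)]

lemma summable_abs_coeff (h : IsHeatSolution T u₀ u) {t : ℝ} (ht : 0 < t) :
    Summable fun n => |2 * sineCoeff u₀ n * Real.exp (-(eigenvalue n * t))| := by
  obtain ⟨M, hM⟩ := h.exists_abs_sineCoeff_le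
  refine ((summable_exp_neg_mul_eigenvalue ht).mul_left (2 * M)).of_nonneg_of_le
    (fun n => abs_nonneg _) fun n => ?_
  rw [abs_mul, abs_mul, Real.abs_exp, abs_two, mul_comm t]
  gcongr
  exact hM n

/-- At almost every time a solution is the sum of its sine series at every point. -/
lemma ae_eq_tsum (h : IsHeatSolution T u₀ u) :
    ∀ᵐ t ∂(volume.restrict (Set.Ioo 0 T)), ∀ x ∈ Set.Ioo (0 : ℝ) 1,
      u t x = ∑' n, 2 * sineCoeff u₀ n * Real.exp (-(eigenvalue n * t)) * sineMode n x := by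
  obtain ⟨w, -, hae, -⟩ := h.equation
  filter_upwards [hae, ae_restrict_mem measurableSet_Ioo] with t hH ht
  have ht' : t ∈ Set.Icc 0 T := ⟨ht.1.le, ht.2.le⟩
  have hsum := h.summable_abs_coeff ht.1
  set b : ℕ → ℝ := fun n => 2 * sineCoeff u₀ n * Real.exp (-(eigenvalue n * t)) with hb
  have hSc : Continuous fun x => ∑' n, b n * sineMode n x := by
    refine continuous_tsum (fun n => by fun_prop) hsum fun n x => ?_
    rw [norm_mul]
    exact mul_le_of_le_one_right (norm_nonneg _) (abs_sineMode_le_one n x)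
  have hS := memLp_unitMeasure_of_continuous hSc.continuousOn
  have hz := ae_eq_zero_of_sineCoeff ((h.memLp t ht').sub hS) fun n => by
    change sineCoeff (fun x => u t x - ∑' n, b n * sineMode n x) n = 0
    rw [sineCoeff_sub (h.memLp t ht') hS, sineCoeff_tsum hsum, h.sineCoeff_eq n ht']
    ring
  have he : u t =ᵐ[volume.restrict (Set.Ioo (0 : ℝ) 1)] fun x => ∑' n, b n * sineMode n x := by
    filter_upwards [hz] with x hx
    exact sub_eq_zero.1 hx
  -- Both sides are continuous in `x`; this is what gives the value at the single point `x₀` a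
  -- meaning.
  exact Measure.eqOn_open_of_ae_eq he isOpen_Ioo (hH.continuousOn.mono Set.Ioo_subset_Icc_self)
    hSc.continuousOn

/-- The factors `e^{-λₙ t}` are at most one, so the tail of the initial datum bounds the error
uniformly in `t`. -/
lemma modeSum_truncation (h : IsHeatSolution T u₀ u) (N : ℕ) {t : ℝ} (ht : t ∈ Set.Icc 0 T) :
    ∫ x in (0 : ℝ)..1, (u t x - modeSum (Finset.range N) (fun n => 2 * sineCoeff u₀ n) t x) ^ 2 ≤
      (∑' n, 2 * sineCoeff u₀ n ^ 2) - ∑ n ∈ Finset.range N, 2 * sineCoeff u₀ n ^ 2 := by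
  have hm := memLp_unitMeasure_of_continuous
    (continuous_modeSum_right (Finset.range N) (fun n => 2 * sineCoeff u₀ n) t).continuousOn
  have h1 := hasSum_sq_sineCoeff ((h.memLp t ht).sub hm)
  have h2 : HasSum (fun n => 2 * sineCoeff u₀ n ^ 2 -
      (if n ∈ Finset.range N then 2 * sineCoeff u₀ n ^ 2 else 0))
      ((∑' n, 2 * sineCoeff u₀ n ^ 2) - ∑ n ∈ Finset.range N, 2 * sineCoeff u₀ n ^ 2) := by
    refine h.summable_sq_sineCoeff.hasSum.sub ?_
    have := hasSum_sum_of_ne_finset_zero (L := .unconditional ℕ) (s := Finset.range N)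
      (f := fun n => if n ∈ Finset.range N then 2 * sineCoeff u₀ n ^ 2 else 0)
      (fun n hn => if_neg hn)
    rwa [Finset.sum_congr rfl fun n hn => if_pos hn] at this
  refine hasSum_le (fun n => ?_) h1 h2
  have h3 : sineCoeff (u t - modeSum (Finset.range N) (fun n => 2 * sineCoeff u₀ n) t) n =
      sineCoeff u₀ n * Real.exp (-(eigenvalue n * t)) -
        if n ∈ Finset.range N then sineCoeff u₀ n * Real.exp (-(eigenvalue n * t)) else 0 := by
    change sineCoeff (fun x => u t x - modeSum _ _ t x) n = _
    rw [sineCoeff_sub (h.memLp t ht) hm, h.sineCoeff_eq n ht]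
    unfold modeSum
    rw [sineCoeff_finset_sum]
    congr 1
    split_ifs <;> ring
  rw [h3]
  split_ifs
  · simp
  · simp only [sub_zero]
    rw [mul_pow]
    have he : Real.exp (-(eigenvalue n * t)) ≤ 1 := by
      rw [Real.exp_le_one_iff]
      have := mul_nonneg (eigenvalue_pos n).le ht.1
      linarith
    have := mul_le_of_le_one_right (sq_nonneg (sineCoeff u₀ n))
      (pow_le_one₀ (n := 2) (Real.exp_pos _).le he)
    linarith

end IsHeatSolution

/-! ### Test solutions and the observability constants. -/

lemma integral_sq_modeSum (s : Finset ℕ) (b : ℕ → ℝ) (t : ℝ) :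
    ∫ x in (0 : ℝ)..1, modeSum s b t x ^ 2 =
      ∑ n ∈ s, b n ^ 2 * Real.exp (-(2 * eigenvalue n * t)) / 2 := by
  have hm := memLp_unitMeasure_of_continuous (continuous_modeSum_right s b t).continuousOn
  have h1 := hasSum_sq_sineCoeff hm
  refine h1.unique ?_
  have h2 := hasSum_sum_of_ne_finset_zero (L := .unconditional ℕ) (s := s)
    (f := fun n => 2 * sineCoeff (modeSum s b t) n ^ 2)
    (fun n hn => by unfold modeSum; rw [sineCoeff_finset_sum, if_neg hn]; simp)
  convert h2 using 1
  refine Finset.sum_congr rfl fun n hn => ?_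
  unfold modeSum
  rw [sineCoeff_finset_sum, if_pos hn, div_pow, mul_pow, sq (Real.exp _), ← Real.exp_add]
  ring_nf

lemma eLpNorm_eq_ofReal_sqrt {v : ℝ → ℝ} (hv : MemLp v 2 unitMeasure) :
    eLpNorm v 2 unitMeasure = ENNReal.ofReal (Real.sqrt (∫ x in (0 : ℝ)..1, v x ^ 2)) := by
  rw [hv.eLpNorm_eq_integral_rpow_norm (by norm_num) (by norm_num), Real.sqrt_eq_rpow,
    intervalIntegral.integral_of_le zero_le_one, ← unitMeasure_eq_Ioc]
  simp

lemma integral_sq_eq_one {v : ℝ → ℝ} (hv : MemLp v 2 unitMeasure) (h : eLpNorm v 2 unitMeasure = 1) :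
    ∫ x in (0 : ℝ)..1, v x ^ 2 = 1 := by
  rw [eLpNorm_eq_ofReal_sqrt hv, ENNReal.ofReal_eq_one, Real.sqrt_eq_one] at h
  exact h

lemma enorm_sq_eq_ofReal (r : ℝ) : ‖r‖ₑ ^ 2 = ENNReal.ofReal (r ^ 2) := by
  rw [Real.enorm_eq_ofReal_abs, ← ENNReal.ofReal_pow (abs_nonneg _), sq_abs]

lemma lintegral_Ioo_ofReal {f : ℝ → ℝ} (hf : Continuous f) (h0 : ∀ x, 0 ≤ f x) {a b : ℝ}
    (hab : a ≤ b) :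
    ∫⁻ x in Set.Ioo a b, ENNReal.ofReal (f x) = ENNReal.ofReal (∫ x in a..b, f x) := by
  rw [intervalIntegral.integral_of_le hab, Measure.restrict_congr_set Ioo_ae_eq_Ioc,
    ofReal_integral_eq_lintegral_ofReal]
  · exact (intervalIntegrable_iff_integrableOn_Ioc_of_le hab).1 (hf.intervalIntegrable _ _)
  · exact Eventually.of_forall h0

lemma lintegral_unitMeasure_enorm_sq {v : ℝ → ℝ} (hv : MemLp v 2 unitMeasure) :
    ∫⁻ x, ‖v x‖ₑ ^ 2 ∂unitMeasure = ENNReal.ofReal (∫ x in (0 : ℝ)..1, v x ^ 2) := by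
  simp_rw [enorm_sq_eq_ofReal]
  rw [intervalIntegral.integral_of_le zero_le_one, ← unitMeasure_eq_Ioc,
    ofReal_integral_eq_lintegral_ofReal hv.integrable_sq
      (Eventually.of_forall fun _ => sq_nonneg _)]

lemma obsConst_le {T : ℝ} {u₀ : ℝ → ℝ} {u : ℝ → ℝ → ℝ} (h : IsHeatSolution T u₀ u)
    (hn : eLpNorm (u T) 2 unitMeasure = 1) (E : Set ℝ) :
    obsConst T E ≤ (∫⁻ t in Set.Ioo (0 : ℝ) T, ∫⁻ x in E, ‖u t x‖ₑ ^ 2) ^ (1 / 2 : ℝ) :=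
  iInf₂_le_of_le u₀ u (iInf₂_le_of_le h hn le_rfl)

lemma pointObsConst_le {T : ℝ} {u₀ : ℝ → ℝ} {u : ℝ → ℝ → ℝ} (h : IsHeatSolution T u₀ u)
    (hn : eLpNorm (u T) 2 unitMeasure = 1) (x₀ : ℝ) :
    pointObsConst T x₀ ≤ (∫⁻ t in Set.Ioo (0 : ℝ) T, ‖u t x₀‖ₑ ^ 2) ^ (1 / 2 : ℝ) :=
  iInf₂_le_of_le u₀ u (iInf₂_le_of_le h hn le_rfl)

/-- By homogeneity, a positive infimum over normalised solutions is a quadratic inequality for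
unnormalised sums. It places no condition on `b`, which permits the later change of coefficients. -/
lemma PointwiseObservable.exists_le_integral_modeSum {T x₀ : ℝ} (hT : 0 < T)
    (hobs : PointwiseObservable T x₀) :
    ∃ c, 0 < c ∧ ∀ (s : Finset ℕ) (b : ℕ → ℝ),
      c * ∑ n ∈ s, b n ^ 2 * Real.exp (-(2 * eigenvalue n * T)) ≤
        ∫ t in (0 : ℝ)..T, modeSum s b t x₀ ^ 2 := by
  obtain ⟨c, hc0, hc, hcP⟩ := ENNReal.lt_iff_exists_real_btwn.1 hobs
  have hcpos : 0 < c := by simpa using hc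
  refine ⟨c ^ 2 / 2, by positivity, fun s b => ?_⟩
  have hI : 0 ≤ ∫ t in (0 : ℝ)..T, modeSum s b t x₀ ^ 2 :=
    intervalIntegral.integral_nonneg hT.le fun _ _ => sq_nonneg _
  set A := ∫ x in (0 : ℝ)..1, modeSum s b T x ^ 2 with hA
  have hAsum : ∑ n ∈ s, b n ^ 2 * Real.exp (-(2 * eigenvalue n * T)) = 2 * A := by
    rw [hA, integral_sq_modeSum, ← Finset.sum_div]; ring
  rw [hAsum]
  have hA0 : 0 ≤ A := intervalIntegral.integral_nonneg zero_le_one fun _ _ => sq_nonneg _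
  rcases hA0.eq_or_lt with hA0 | hA0
  · rw [← hA0]; simpa using hI
  set b' : ℕ → ℝ := fun n => (Real.sqrt A)⁻¹ * b n with hb'
  have hscale : ∀ t x, modeSum s b' t x = (Real.sqrt A)⁻¹ * modeSum s b t x := fun t x => by
    simp only [modeSum, hb', Finset.mul_sum, mul_assoc]
  have hsq : (Real.sqrt A)⁻¹ ^ 2 = A⁻¹ := by rw [inv_pow, Real.sq_sqrt hA0.le]
  have hnorm : eLpNorm (modeSum s b' T) 2 unitMeasure = 1 := by
    rw [eLpNorm_eq_ofReal_sqrt (memLp_unitMeasure_of_continuous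
      (continuous_modeSum_right s b' T).continuousOn)]
    simp_rw [hscale, mul_pow, hsq]
    rw [intervalIntegral.integral_const_mul, ← hA, inv_mul_cancel₀ hA0.ne']
    simp
  have h1 := hcP.le.trans (pointObsConst_le (isHeatSolution_modeSum T s b') hnorm x₀)
  simp_rw [enorm_sq_eq_ofReal] at h1
  rw [lintegral_Ioo_ofReal (f := fun t => modeSum s b' t x₀ ^ 2)
      ((continuous_modeSum_left s b' x₀).pow 2) (fun _ => sq_nonneg _) hT.le,
    ENNReal.ofReal_rpow_of_nonneg
      (intervalIntegral.integral_nonneg hT.le fun _ _ => sq_nonneg _) (by norm_num),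
    ← Real.sqrt_eq_rpow, ENNReal.ofReal_le_ofReal_iff (Real.sqrt_nonneg _),
    Real.le_sqrt' hcpos] at h1
  simp_rw [hscale, mul_pow, hsq] at h1
  rw [intervalIntegral.integral_const_mul, le_inv_mul_iff₀ hA0] at h1
  linarith

/-- With `k = (n+1)π`, `q = sineMode n x₀ ^ 2` and `y = sin(2kε)/(2k)`, the integral is exactly `ε -
y(1 - 2q)`, and `-ε/2 ≤ y ≤ ε` whatever the frequency. The constant is thus uniform in `n`. -/
lemma half_mul_sq_sineMode_le_integral (n : ℕ) (x₀ : ℝ) {ε : ℝ} (hε : 0 < ε) :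
    ε / 2 * sineMode n x₀ ^ 2 ≤ ∫ x in (x₀ - ε)..(x₀ + ε), sineMode n x ^ 2 := by
  set k : ℝ := (n + 1) * Real.pi with hk
  have hk0 : 0 < k := by positivity
  have hd : ∀ x, HasDerivAt (fun x => x / 2 - Real.sin (2 * k * x) / (4 * k))
      (sineMode n x ^ 2) x := fun x => by
    refine (((hasDerivAt_id' x).div_const 2).sub
      ((((hasDerivAt_id' x).const_mul (2 * k)).sin).div_const (4 * k))).congr_deriv ?_
    rw [show 2 * k * x = 2 * (k * x) by ring, Real.cos_two_mul, Real.cos_sq']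
    unfold sineMode
    rw [← hk]
    field_simp
    ring
  rw [intervalIntegral.integral_eq_sub_of_hasDerivAt (fun x _ => hd x)
    (Continuous.intervalIntegrable (by fun_prop) _ _)]
  have hs : (x₀ + ε) / 2 - Real.sin (2 * k * (x₀ + ε)) / (4 * k) -
      ((x₀ - ε) / 2 - Real.sin (2 * k * (x₀ - ε)) / (4 * k)) =
      ε - Real.sin (2 * k * ε) / (2 * k) * (1 - 2 * sineMode n x₀ ^ 2) := by
    rw [mul_add, mul_sub, Real.sin_add, Real.sin_sub,
      show 2 * k * x₀ = 2 * (k * x₀) by ring, Real.cos_two_mul, Real.cos_sq']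
    unfold sineMode
    rw [← hk]
    field_simp
    ring
  rw [hs]
  set q := sineMode n x₀ ^ 2 with hq
  have hq0 : 0 ≤ q := sq_nonneg _
  have hq1 : q ≤ 1 := by
    rw [hq, ← sq_abs]
    exact pow_le_one₀ (abs_nonneg _) (abs_sineMode_le_one n x₀)
  set y := Real.sin (2 * k * ε) / (2 * k) with hy
  have hz : 0 < 2 * k * ε := by positivity
  have hy1 : y ≤ ε := by
    rw [hy, div_le_iff₀ (by positivity)]
    linarith [Real.sin_le hz.le]
  have hy2 : -(ε / 2) ≤ y := by
    rw [hy, le_div_iff₀ (by positivity)]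
    rcases le_total (2 * k * ε) Real.pi with hzp | hzp
    · linarith [Real.sin_nonneg_of_nonneg_of_le_pi hz.le hzp]
    · linarith [Real.neg_one_le_sin (2 * k * ε), Real.pi_gt_three]
  rcases le_total 0 y with h | h
  · nlinarith [mul_nonneg h hq0, mul_nonneg (sub_nonneg.2 hy1) (sub_nonneg.2 hq1)]
  · nlinarith [mul_nonneg (neg_nonneg.2 h) (sub_nonneg.2 hq1), mul_nonneg hε.le hq0]

/-- The competitor is the single mode `n`, normalised at time `T`; its amplitude at time `t` brings
in `e^{2λₙ(T-t)}`. -/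
lemma obsConst_Ioo_le (n : ℕ) {T : ℝ} (hT : 0 < T) {a b m : ℝ} (hab : a ≤ b)
    (hm : ∀ x ∈ Set.Ioo a b, |sineMode n x| ≤ m) :
    obsConst T (Set.Ioo a b) ≤ ENNReal.ofReal
      ((m ^ 2 * (b - a) * (Real.exp (2 * eigenvalue n * T) / eigenvalue n)) ^ (1 / 2 : ℝ)) := by
  -- The factor `√2` compensates `∫ sin² = 1/2`.
  set c : ℝ := Real.sqrt 2 * Real.exp (eigenvalue n * T) with hc
  have hlam := eigenvalue_pos n
  have hu : ∀ t x, modeSum {n} (fun _ => c) t x ^ 2 =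
      2 * Real.exp (2 * eigenvalue n * (T - t)) * sineMode n x ^ 2 := fun t x => by
    simp only [modeSum, Finset.sum_singleton, hc]
    rw [mul_assoc (Real.sqrt 2), ← Real.exp_add, mul_pow, mul_pow, Real.sq_sqrt (by norm_num),
      sq (Real.exp _), ← Real.exp_add]
    ring_nf
  have hnorm : eLpNorm (modeSum {n} (fun _ => c) T) 2 unitMeasure = 1 := by
    rw [eLpNorm_eq_ofReal_sqrt (memLp_unitMeasure_of_continuous
      (continuous_modeSum_right _ _ T).continuousOn), integral_sq_modeSum]
    rw [Finset.sum_singleton, hc, mul_pow, Real.sq_sqrt (by norm_num), sq (Real.exp _), mul_assoc,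
      ← Real.exp_add, ← Real.exp_add]
    ring_nf
    simp
  refine (obsConst_le (isHeatSolution_modeSum T {n} fun _ => c) hnorm _).trans ?_
  have hba : 0 ≤ b - a := sub_nonneg.2 hab
  rw [← ENNReal.ofReal_rpow_of_nonneg (by positivity) (by norm_num)]
  gcongr
  have hin : ∀ t, ∫⁻ x in Set.Ioo a b, ‖modeSum {n} (fun _ => c) t x‖ₑ ^ 2 ≤
      ENNReal.ofReal (m ^ 2 * (b - a) * (2 * Real.exp (2 * eigenvalue n * (T - t)))) := fun t => by
    calc _ ≤ ∫⁻ x in Set.Ioo a b, ENNReal.ofReal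
          (2 * Real.exp (2 * eigenvalue n * (T - t)) * m ^ 2) := by
          refine setLIntegral_mono' measurableSet_Ioo fun x hx => ?_
          rw [enorm_sq_eq_ofReal, hu]
          gcongr 1
          rw [← sq_abs (sineMode n x)]
          gcongr
          exact hm x hx
      _ = _ := by
          rw [setLIntegral_const, Real.volume_Ioo, ← ENNReal.ofReal_mul (by positivity)]
          ring_nf
  refine (lintegral_mono hin).trans ?_
  rw [lintegral_Ioo_ofReal (by fun_prop) (fun _ => by positivity) hT.le]
  gcongr 1
  rw [intervalIntegral.integral_const_mul]
  gcongr
  have hd : ∀ t, HasDerivAt (fun t => -(Real.exp (2 * eigenvalue n * (T - t)) / eigenvalue n))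
      (2 * Real.exp (2 * eigenvalue n * (T - t))) t := fun t => by
    refine (((((hasDerivAt_id' t).const_sub T).const_mul (2 * eigenvalue n)).exp).div_const
      (eigenvalue n)).fun_neg.congr_deriv ?_
    field_simp
  rw [intervalIntegral.integral_eq_sub_of_hasDerivAt (fun t _ => hd t)
    (Continuous.intervalIntegrable (by fun_prop) _ _)]
  have : 0 < Real.exp (2 * eigenvalue n * (T - T)) / eigenvalue n := by positivity
  simp only [sub_zero]
  linarith

/-! ### Lower bound on intervals. -/

/-- Observability at `x₀` of finite superpositions gives their observability on neighbourhoods of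
`x₀`: replacing each coefficient `bₙ` by `bₙ sin((n+1)πx) / sin((n+1)πx₀)` moves the observation
point from `x` to `x₀`. -/
lemma PointwiseObservable.exists_le_lintegral_Ioo {T x₀ : ℝ} (hT : 0 < T)
    (hobs : PointwiseObservable T x₀) :
    ∃ c, 0 < c ∧ ∀ (s : Finset ℕ) (b : ℕ → ℝ) (ε : ℝ), 0 < ε →
      ENNReal.ofReal (c * ε * ∑ n ∈ s, b n ^ 2 * Real.exp (-(2 * eigenvalue n * T))) ≤
        ∫⁻ t in Set.Ioo (0 : ℝ) T, ∫⁻ x in Set.Ioo (x₀ - ε) (x₀ + ε), ‖modeSum s b t x‖ₑ ^ 2 := by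
  obtain ⟨c, hc, h⟩ := hobs.exists_le_integral_modeSum hT
  -- A mode vanishing at `x₀` would have zero trace there and contradict the inequality for the
  -- singleton `{n}`.
  have hne : ∀ n, sineMode n x₀ ≠ 0 := fun n hn => by
    have := h {n} fun _ => 1
    simp only [modeSum, Finset.sum_singleton, hn] at this
    simp at this
    have := Real.exp_pos (-(2 * eigenvalue n * T))
    nlinarith
  refine ⟨c / 2, by positivity, fun s b ε hε => ?_⟩
  have hmove : ∀ x, c * ∑ n ∈ s, b n ^ 2 / sineMode n x₀ ^ 2 *
      Real.exp (-(2 * eigenvalue n * T)) * sineMode n x ^ 2 ≤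
      ∫ t in (0 : ℝ)..T, modeSum s b t x ^ 2 := fun x => by
    have := h s fun n => b n * sineMode n x / sineMode n x₀
    have hx : ∀ t, modeSum s (fun n => b n * sineMode n x / sineMode n x₀) t x₀ =
        modeSum s b t x := fun t => by
      refine Finset.sum_congr rfl fun n _ => ?_
      have := hne n
      field_simp
    simp_rw [hx] at this
    refine le_trans (le_of_eq ?_) this
    congr 1
    refine Finset.sum_congr rfl fun n _ => ?_
    ring
  have hmeas : Measurable (Function.uncurry fun t x => ‖modeSum s b t x‖ₑ ^ 2) :=
    (continuous_uncurry_modeSum s b).measurable.enorm.pow_const 2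
  -- Tonelli: the time integral at each fixed `x` is bounded first by `hmove`, then integrated in
  -- `x`.
  rw [lintegral_lintegral_swap hmeas.aemeasurable]
  calc _ ≤ ENNReal.ofReal (∫ x in (x₀ - ε)..(x₀ + ε), c * ∑ n ∈ s, b n ^ 2 / sineMode n x₀ ^ 2 *
        Real.exp (-(2 * eigenvalue n * T)) * sineMode n x ^ 2) := by
        gcongr 1
        rw [intervalIntegral.integral_const_mul, intervalIntegral.integral_finsetSum fun n _ =>
          Continuous.intervalIntegrable (by fun_prop) _ _,
          show c / 2 * ε * ∑ n ∈ s, b n ^ 2 * Real.exp (-(2 * eigenvalue n * T)) =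
            c * ∑ n ∈ s, ε / 2 * (b n ^ 2 * Real.exp (-(2 * eigenvalue n * T))) by
            rw [← Finset.mul_sum]; ring]
        gcongr with n hn
        rw [intervalIntegral.integral_const_mul]
        have hq := hne n
        calc ε / 2 * (b n ^ 2 * Real.exp (-(2 * eigenvalue n * T))) =
            b n ^ 2 / sineMode n x₀ ^ 2 * Real.exp (-(2 * eigenvalue n * T)) *
              (ε / 2 * sineMode n x₀ ^ 2) := by field_simp
          _ ≤ _ := by
            gcongr
            exact half_mul_sq_sineMode_le_integral n x₀ hε
    _ = ∫⁻ x in Set.Ioo (x₀ - ε) (x₀ + ε), ENNReal.ofReal (c * ∑ n ∈ s,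
        b n ^ 2 / sineMode n x₀ ^ 2 * Real.exp (-(2 * eigenvalue n * T)) * sineMode n x ^ 2) :=
        (lintegral_Ioo_ofReal (by fun_prop)
          (fun x => mul_nonneg hc.le (Finset.sum_nonneg fun n _ => by positivity))
          (by linarith)).symm
    _ ≤ _ := by
        refine lintegral_mono fun x => ?_
        simp_rw [enorm_sq_eq_ofReal]
        rw [lintegral_Ioo_ofReal (f := fun t => modeSum s b t x ^ 2)
          ((continuous_modeSum_left s b x).pow 2) (fun _ => sq_nonneg _) hT.le]
        exact ENNReal.ofReal_le_ofReal (hmove x)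

lemma IsHeatSolution.lintegral_modeSum_le {T : ℝ} {u₀ : ℝ → ℝ} {u : ℝ → ℝ → ℝ}
    (h : IsHeatSolution T u₀ u) (N : ℕ) {E : Set ℝ} (hE : E ⊆ Set.Ioo 0 1) {t : ℝ}
    (ht : t ∈ Set.Icc 0 T) :
    ∫⁻ x in E, ‖modeSum (Finset.range N) (fun n => 2 * sineCoeff u₀ n) t x‖ₑ ^ 2 ≤
      2 * (∫⁻ x in E, ‖u t x‖ₑ ^ 2) + ENNReal.ofReal (2 *
        ((∑' n, 2 * sineCoeff u₀ n ^ 2) - ∑ n ∈ Finset.range N, 2 * sineCoeff u₀ n ^ 2)) := by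
  set v := modeSum (Finset.range N) (fun n => 2 * sineCoeff u₀ n) t with hv
  have hm : MemLp v 2 unitMeasure :=
    memLp_unitMeasure_of_continuous (continuous_modeSum_right _ _ t).continuousOn
  have hpt : ∀ x, ‖v x‖ₑ ^ 2 ≤ 2 * ‖u t x‖ₑ ^ 2 + 2 * ‖(u t - v) x‖ₑ ^ 2 := fun x => by
    simp_rw [enorm_sq_eq_ofReal]
    rw [← ENNReal.ofReal_ofNat, ← ENNReal.ofReal_mul (by norm_num),
      ← ENNReal.ofReal_mul (by norm_num), ← ENNReal.ofReal_add (by positivity) (by positivity)]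
    gcongr
    simp only [Pi.sub_apply]
    nlinarith [sq_nonneg (2 * u t x - v x)]
  have hle : volume.restrict E ≤ unitMeasure := Measure.restrict_mono hE le_rfl
  have hum : AEMeasurable (fun x => 2 * ‖u t x‖ₑ ^ 2) (volume.restrict E) :=
    (((h.memLp t ht).aestronglyMeasurable.mono_measure hle).enorm.pow_const 2).const_mul 2
  refine (lintegral_mono hpt).trans ?_
  rw [lintegral_add_left' hum, lintegral_const_mul' _ _ (by norm_num),
    lintegral_const_mul' _ _ (by norm_num), ENNReal.ofReal_mul (by norm_num),
    ENNReal.ofReal_ofNat]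
  gcongr
  refine (lintegral_mono' hle le_rfl).trans ?_
  rw [lintegral_unitMeasure_enorm_sq ((h.memLp t ht).sub hm)]
  exact ENNReal.ofReal_le_ofReal (h.modeSum_truncation N ht)

/-- Observability at `x₀` in time `T'` gives observability in time `T ≥ T'` on every interval
around `x₀`, with cost of the order of the square root of its length. -/
theorem PointwiseObservable.exists_le_obsConst {T T' x₀ : ℝ} (hT' : 0 < T') (hTT : T' ≤ T)
    (hobs : PointwiseObservable T' x₀) :
    ∃ C, 0 < C ∧ ∀ ε : ℝ, 0 < ε → Set.Ioo (x₀ - ε) (x₀ + ε) ⊆ Set.Ioo (0 : ℝ) 1 →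
      ENNReal.ofReal (C * ε ^ (1 / 2 : ℝ)) ≤ obsConst T (Set.Ioo (x₀ - ε) (x₀ + ε)) := by
  obtain ⟨c, hc, h⟩ := hobs.exists_le_lintegral_Ioo hT'
  refine ⟨c ^ (1 / 2 : ℝ), by positivity, fun ε hε hsub => ?_⟩
  have hT : 0 ≤ T := hT'.le.trans hTT
  refine le_iInf₂ fun u₀ u => le_iInf₂ fun hu hn => ?_
  rw [← Real.mul_rpow hc.le hε.le, ← ENNReal.ofReal_rpow_of_nonneg (by positivity) (by norm_num)]
  gcongr
  set E := Set.Ioo (x₀ - ε) (x₀ + ε) with hE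
  set I := ∫⁻ t in Set.Ioo (0 : ℝ) T, ∫⁻ x in E, ‖u t x‖ₑ ^ 2 with hI
  set α := sineCoeff u₀ with hα
  set r : ℕ → ℝ := fun N => (∑' n, 2 * α n ^ 2) - ∑ n ∈ Finset.range N, 2 * α n ^ 2 with hr
  have hrlim : Tendsto r atTop (𝓝 0) := by
    have := (tendsto_const_nhds (x := ∑' n, 2 * α n ^ 2)).sub
      hu.summable_sq_sineCoeff.hasSum.tendsto_sum_nat
    simpa [hr, hα] using this
  have hTm : T ∈ Set.Icc 0 T := ⟨hT, le_rfl⟩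
  have hone := hu.hasSum_integral_sq hTm
  rw [integral_sq_eq_one (hu.memLp T hTm) hn] at hone
  -- The larger time `T` only helps: it lowers the final norm and enlarges the observation. The
  -- truncation error `r N` tends to zero, and the factor 2 on both sides cancels at the end.
  have hbound : ∀ N, ENNReal.ofReal (2 * (c * ε) * ∑ n ∈ Finset.range N,
      2 * α n ^ 2 * Real.exp (-(2 * eigenvalue n * T))) ≤
      2 * I + ENNReal.ofReal (2 * r N) * ENNReal.ofReal T := fun N => by
    calc _ ≤ ENNReal.ofReal (c * ε * ∑ n ∈ Finset.range N,
          (2 * α n) ^ 2 * Real.exp (-(2 * eigenvalue n * T'))) := by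
          gcongr 1
          rw [mul_comm 2 (c * ε), mul_assoc (c * ε), Finset.mul_sum]
          refine mul_le_mul_of_nonneg_left (Finset.sum_le_sum fun n _ => ?_) (by positivity)
          have : Real.exp (-(2 * eigenvalue n * T)) ≤ Real.exp (-(2 * eigenvalue n * T')) := by
            have := eigenvalue_pos n
            gcongr
          nlinarith [mul_le_mul_of_nonneg_left this (sq_nonneg (α n))]
      _ ≤ _ := h (Finset.range N) (fun n => 2 * α n) ε hε
      _ ≤ ∫⁻ t in Set.Ioo (0 : ℝ) T, ∫⁻ x in E,
          ‖modeSum (Finset.range N) (fun n => 2 * α n) t x‖ₑ ^ 2 :=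
          lintegral_mono_set (Set.Ioo_subset_Ioo_right hTT)
      _ ≤ ∫⁻ t in Set.Ioo (0 : ℝ) T, (2 * (∫⁻ x in E, ‖u t x‖ₑ ^ 2) +
          ENNReal.ofReal (2 * r N)) :=
          setLIntegral_mono' measurableSet_Ioo fun t ht =>
            hu.lintegral_modeSum_le N hsub ⟨ht.1.le, ht.2.le⟩
      _ = _ := by
          rw [lintegral_add_right _ measurable_const, lintegral_const_mul' _ _ (by norm_num),
            setLIntegral_const, Real.volume_Ioo, sub_zero]
  have hlimL := (ENNReal.continuous_ofReal.tendsto _).comp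
    (hone.tendsto_sum_nat.const_mul (2 * (c * ε)))
  have hlimR : Tendsto (fun N => 2 * I + ENNReal.ofReal (2 * r N) * ENNReal.ofReal T) atTop
      (𝓝 (2 * I)) := by
    have h1 : Tendsto (fun N => ENNReal.ofReal (2 * r N * T)) atTop (𝓝 0) := by
      have := (ENNReal.continuous_ofReal.tendsto _).comp ((hrlim.const_mul 2).mul_const T)
      simpa [Function.comp_def] using this
    have h2 := (tendsto_const_nhds (x := 2 * I)).add h1
    simp_rw [ENNReal.ofReal_mul' hT, add_zero] at h2
    exact h2
  have hfin := le_of_tendsto_of_tendsto' hlimL hlimR hbound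
  rw [mul_one, ENNReal.ofReal_mul (by norm_num), ENNReal.ofReal_ofNat] at hfin
  exact (ENNReal.mul_le_mul_iff_right (by norm_num) (by norm_num)).1 hfin

/-! ### Pointwise observability and the size of the eigenfunctions at `x₀`. -/

/-- If the eigenfunctions at `x₀` decay no faster than `e^{-λₙ S}`, then the heat equation is
observable at `x₀` in every time `T > S`. -/
theorem pointwiseObservable_of_le_abs_sineMode {x₀ S T κ : ℝ} (hx₀ : x₀ ∈ Set.Ioo (0 : ℝ) 1)
    (hS : 0 ≤ S) (hST : S < T) (hκ : 0 < κ)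
    (h : ∀ n, κ * Real.exp (-(eigenvalue n * S)) ≤ |sineMode n x₀|) :
    PointwiseObservable T x₀ := by
  -- Writing `T = S + 2σ`, one `σ` delays the start so that the series converges absolutely, the
  -- other absorbs `growth n`.
  set σ := (T - S) / 2 with hσd
  have hσ : 0 < σ := by rw [hσd]; linarith
  have hτ : 0 < T - σ := by rw [hσd]; linarith
  obtain ⟨C, hC, hcoef⟩ := exists_sq_coeff_le_integral hτ
  set ζ : ℕ → ℝ := fun n => C / (2 * κ ^ 2) * (growth n * Real.exp (-(2 * σ * eigenvalue n)))
    with hζ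
  have hζs : Summable ζ := (summable_growth_mul_exp (by positivity)).mul_left _
  have hζ0 : ∀ n, 0 ≤ ζ n := fun n => by
    have := growth_pos n
    simp only [hζ]
    positivity
  set Z := (∑' n, ζ n) + 1 with hZ
  have hZ0 : 0 < Z := by
    have : 0 ≤ ∑' n, ζ n := tsum_nonneg hζ0
    linarith
  have hpos : 0 < ENNReal.ofReal (1 / Z) ^ (1 / 2 : ℝ) :=
    ENNReal.rpow_pos (by simpa using hZ0) ENNReal.ofReal_ne_top
  refine hpos.trans_le (le_iInf₂ fun u₀ u => le_iInf₂ fun hu hn => ?_)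
  gcongr
  set α := sineCoeff u₀ with hα
  set f : ℝ → ℝ := fun t => ∑' n, 2 * α n * Real.exp (-(eigenvalue n * t)) * sineMode n x₀ with hf
  set c : ℕ → ℝ := fun n => 2 * α n * Real.exp (-(eigenvalue n * σ)) * sineMode n x₀ with hc
  have hcs : Summable fun n => |c n| := by
    refine (hu.summable_abs_coeff hσ).of_nonneg_of_le (fun n => abs_nonneg _) fun n => ?_
    rw [hc, abs_mul]
    exact mul_le_of_le_one_right (abs_nonneg _) (abs_sineMode_le_one n x₀)
  have hfc : ContinuousOn f (Set.Ici σ) := by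
    refine continuousOn_tsum (fun n => by fun_prop) (hu.summable_abs_coeff hσ) fun n t ht => ?_
    rw [norm_mul, Real.norm_eq_abs]
    refine (mul_le_of_le_one_right (abs_nonneg _) (abs_sineMode_le_one n x₀)).trans ?_
    rw [abs_mul, abs_mul _ (Real.exp (-(eigenvalue n * σ))), Real.abs_exp, Real.abs_exp]
    have := eigenvalue_pos n
    have : σ ≤ t := ht
    gcongr
  have hσT : σ ≤ T := by linarith
  set J := ∫ t in σ..T, f t ^ 2 with hJ
  have hshift : ∫ t in (0 : ℝ)..(T - σ), (∑' n, c n * Real.exp (-(eigenvalue n * t))) ^ 2 = J := by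
    have h1 : ∀ t, ∑' n, c n * Real.exp (-(eigenvalue n * t)) = f (t + σ) := fun t => by
      refine tsum_congr fun n => ?_
      simp only [hc]
      rw [mul_add, neg_add, Real.exp_add]
      ring
    simp_rw [h1]
    rw [intervalIntegral.integral_comp_add_right fun t => f t ^ 2]
    simp [hJ]
  have hTm : T ∈ Set.Icc 0 T := ⟨by linarith, le_rfl⟩
  have hone := hu.hasSum_integral_sq hTm
  rw [integral_sq_eq_one (hu.memLp T hTm) hn] at hone
  have hJ0 : 0 ≤ J := intervalIntegral.integral_nonneg hσT fun _ _ => sq_nonneg _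
  have hterm : ∀ n, 2 * α n ^ 2 * Real.exp (-(2 * eigenvalue n * T)) ≤ ζ n * J := fun n => by
    have h1 := hcoef c hcs n
    rw [hshift] at h1
    have h2 : κ ^ 2 * Real.exp (-(2 * eigenvalue n * S)) ≤ sineMode n x₀ ^ 2 := by
      rw [← sq_abs (sineMode n x₀)]
      calc _ = (κ * Real.exp (-(eigenvalue n * S))) ^ 2 := by
            rw [mul_pow, sq (Real.exp _), ← Real.exp_add]; ring_nf
        _ ≤ _ := by gcongr; exact h n
    have h3 : c n ^ 2 = 4 * α n ^ 2 * Real.exp (-(2 * eigenvalue n * σ)) * sineMode n x₀ ^ 2 := by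
      simp only [hc]
      rw [mul_pow, mul_pow, sq (Real.exp _), ← Real.exp_add]; ring_nf
    have h4 : Real.exp (-(2 * eigenvalue n * T)) = Real.exp (-(2 * eigenvalue n * S)) *
        Real.exp (-(2 * eigenvalue n * σ)) * Real.exp (-(2 * σ * eigenvalue n)) := by
      rw [← Real.exp_add, ← Real.exp_add, hσd]; ring_nf
    rw [h3] at h1
    calc 2 * α n ^ 2 * Real.exp (-(2 * eigenvalue n * T)) =
        1 / (2 * κ ^ 2) * (4 * α n ^ 2 * Real.exp (-(2 * eigenvalue n * σ)) *
          (κ ^ 2 * Real.exp (-(2 * eigenvalue n * S)))) *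
          Real.exp (-(2 * σ * eigenvalue n)) := by
          rw [h4]; field_simp; ring
      _ ≤ 1 / (2 * κ ^ 2) * (4 * α n ^ 2 * Real.exp (-(2 * eigenvalue n * σ)) *
          sineMode n x₀ ^ 2) * Real.exp (-(2 * σ * eigenvalue n)) := by gcongr
      _ ≤ 1 / (2 * κ ^ 2) * (C * growth n * J) * Real.exp (-(2 * σ * eigenvalue n)) := by gcongr
      _ = ζ n * J := by simp only [hζ]; ring
  have hsum : 1 ≤ (∑' n, ζ n) * J := hasSum_le hterm hone (hζs.hasSum.mul_right J)
  have hJZ : 1 / Z ≤ J := by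
    rw [div_le_iff₀ hZ0, hZ]
    nlinarith
  calc ENNReal.ofReal (1 / Z) ≤ ENNReal.ofReal J := ENNReal.ofReal_le_ofReal hJZ
    _ = ∫⁻ t in Set.Ioo σ T, ENNReal.ofReal (f t ^ 2) := by
        rw [hJ, intervalIntegral.integral_of_le hσT, Measure.restrict_congr_set Ioo_ae_eq_Ioc,
          ofReal_integral_eq_lintegral_ofReal]
        · refine (intervalIntegrable_iff_integrableOn_Ioc_of_le hσT).1
            (ContinuousOn.intervalIntegrable ?_)
          rw [Set.uIcc_of_le hσT]
          exact (hfc.mono Set.Icc_subset_Ici_self).pow 2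
        · exact Eventually.of_forall fun _ => sq_nonneg _
    _ = ∫⁻ t in Set.Ioo σ T, ‖u t x₀‖ₑ ^ 2 := by
        refine lintegral_congr_ae ?_
        filter_upwards [ae_restrict_of_ae_restrict_of_subset
          (Set.Ioo_subset_Ioo_left hσ.le) hu.ae_eq_tsum] with t ht
        rw [enorm_sq_eq_ofReal, ht x₀ hx₀]
    _ ≤ _ := lintegral_mono_set (Set.Ioo_subset_Ioo_left hσ.le)

/-- If the heat equation is not observable at `x₀` in time `T`, infinitely many eigenfunctions
are exponentially small at `x₀`. -/
theorem frequently_abs_sineMode_le {x₀ S T : ℝ} (hx₀ : x₀ ∈ Set.Ioo (0 : ℝ) 1)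
    (hS : 0 ≤ S) (hST : S < T) (h : ¬ PointwiseObservable T x₀) :
    ∃ᶠ n in atTop, |sineMode n x₀| ≤ Real.exp (-(eigenvalue n * S)) := by
  by_contra hcon
  rw [not_frequently] at hcon
  simp only [not_le] at hcon
  obtain ⟨N, hN⟩ := eventually_atTop.1 hcon
  -- If frequency `n+1` vanishes at `x₀`, so do all its multiples, some of them beyond `N`, where a
  -- positive lower bound holds. The `- 1` converts a frequency to an index.
  have hne : ∀ n, sineMode n x₀ ≠ 0 := fun n hn => by
    have hz : sineMode ((N + 1) * (n + 1) - 1) x₀ = 0 := by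
      have hcast : (((N + 1) * (n + 1) - 1 : ℕ) : ℝ) + 1 = (N + 1) * (n + 1) := by
        rw [Nat.cast_sub (Nat.mul_pos N.succ_pos n.succ_pos)]
        push_cast; ring
      unfold sineMode at hn ⊢
      rw [hcast]
      obtain ⟨k, hk⟩ := Real.sin_eq_zero_iff.1 hn
      rw [Real.sin_eq_zero_iff]
      refine ⟨(N + 1) * k, ?_⟩
      push_cast
      rw [mul_assoc, hk]; ring
    have hge : N ≤ (N + 1) * (n + 1) - 1 := by
      have : N + 1 ≤ (N + 1) * (n + 1) := Nat.le_mul_of_pos_right _ n.succ_pos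
      omega
    have := hN _ hge
    rw [hz, abs_zero] at this
    exact absurd this (not_lt.2 (Real.exp_pos _).le)
  obtain ⟨κ, hκ, hκle⟩ : ∃ κ : ℝ, 0 < κ ∧ ∀ n < N, κ ≤ |sineMode n x₀| := by
    clear hN
    induction N with
    | zero => exact ⟨1, one_pos, by simp⟩
    | succ N ih =>
      obtain ⟨κ, hκ, hle⟩ := ih
      refine ⟨min κ |sineMode N x₀|, lt_min hκ (abs_pos.2 (hne N)), fun n hn => ?_⟩
      rcases Nat.lt_succ_iff_lt_or_eq.1 hn with hn | rfl
      · exact (min_le_left _ _).trans (hle n hn)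
      · exact min_le_right _ _
  refine h (pointwiseObservable_of_le_abs_sineMode hx₀ hS hST (lt_min hκ one_pos) fun n => ?_)
  have he : Real.exp (-(eigenvalue n * S)) ≤ 1 := by
    rw [Real.exp_le_one_iff]
    have := mul_nonneg (eigenvalue_pos n).le hS
    linarith
  rcases lt_or_ge n N with hn | hn
  · refine le_trans ?_ (hκle n hn)
    exact (mul_le_of_le_one_right (lt_min hκ one_pos).le he).trans (min_le_left _ _)
  · refine le_trans ?_ (hN n hn).le
    exact mul_le_of_le_one_left (Real.exp_pos _).le (min_le_right _ _)

/-! ### A badly observed mode, and the theorem. -/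

lemma Ioo_subset_unit_iff {x₀ ε : ℝ} (hε : 0 < ε) :
    Set.Ioo (x₀ - ε) (x₀ + ε) ⊆ Set.Ioo (0 : ℝ) 1 ↔ ε ≤ x₀ ∧ ε ≤ 1 - x₀ := by
  rw [Set.Ioo_subset_Ioo_iff (by linarith)]
  constructor <;> rintro ⟨h1, h2⟩ <;> constructor <;> linarith

lemma abs_sineMode_le_of_mem_Ioo {n : ℕ} {x₀ ε x : ℝ}
    (h : |sineMode n x₀| ≤ ε) (hx : x ∈ Set.Ioo (x₀ - ε) (x₀ + ε)) :
    |sineMode n x| ≤ 2 * ((n + 1) * Real.pi) * ε := by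
  set k : ℝ := (n + 1) * Real.pi with hk
  have hk1 : 1 ≤ k := by
    have := Real.pi_gt_three
    have hn : (0 : ℝ) ≤ n := n.cast_nonneg
    rw [hk]; nlinarith
  have h1 : |sineMode n x - sineMode n x₀| ≤ k * |x - x₀| := by
    have := Convex.norm_image_sub_le_of_norm_hasDerivWithin_le (s := Set.univ) (C := k)
      (fun y _ => (hasDerivAt_sineMode n y).hasDerivWithinAt) (fun y _ => ?_) convex_univ
      (Set.mem_univ x₀) (Set.mem_univ x)
    · simpa [Real.norm_eq_abs] using this
    · rw [norm_mul, ← hk, Real.norm_of_nonneg (by linarith)]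
      exact mul_le_of_le_one_right (by linarith) (Real.abs_cos_le_one _)
  have h2 : |x - x₀| ≤ ε := abs_le.2 ⟨by linarith [hx.1], by linarith [hx.2]⟩
  have h3 : |sineMode n x| ≤ |sineMode n x - sineMode n x₀| + |sineMode n x₀| := by
    simpa using abs_add_le (sineMode n x - sineMode n x₀) (sineMode n x₀)
  have hε : 0 ≤ ε := (abs_nonneg _).trans h
  nlinarith [mul_le_mul_of_nonneg_left h2 (by linarith : 0 ≤ k),
    mul_le_mul_of_nonneg_right hk1 hε]

/-- An eigenfunction of size at most `ε = e^{-λₙ S}` at `x₀` yields a solution that is badly observed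
on the `ε`-neighbourhood of `x₀`. -/
lemma obsConst_le_of_abs_sineMode_le {n : ℕ} {x₀ S T ε : ℝ} (hT : 0 < T) (hTS : T < S)
    (hε : ε = Real.exp (-(eigenvalue n * S))) (h : |sineMode n x₀| ≤ ε) :
    obsConst T (Set.Ioo (x₀ - ε) (x₀ + ε)) ≤
      ENNReal.ofReal (8 ^ (1 / 2 : ℝ) * ε ^ (3 / 2 - T / S)) := by
  have hε0 : 0 < ε := hε ▸ Real.exp_pos _
  have hlam := eigenvalue_pos n
  have hS : 0 < S := hT.trans hTS
  refine (obsConst_Ioo_le n hT (by linarith) fun x hx =>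
    abs_sineMode_le_of_mem_Ioo h hx).trans (le_of_eq ?_)
  congr 1
  have hexp : Real.exp (2 * eigenvalue n * T) = ε ^ (-(2 * (T / S))) := by
    rw [hε, ← Real.exp_mul]
    congr 1
    field_simp
  have h3 : (2 * (((n : ℝ) + 1) * Real.pi) * ε) ^ 2 * (x₀ + ε - (x₀ - ε)) *
      (Real.exp (2 * eigenvalue n * T) / eigenvalue n) = 8 * ε ^ (3 - 2 * (T / S)) := by
    -- The square of the Lipschitz constant produces `λₙ`, which cancels the `1/λₙ` from the time
    -- integral and leaves a pure power of `ε`.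
    have hk : (2 * (((n : ℝ) + 1) * Real.pi) * ε) ^ 2 = 4 * eigenvalue n * ε ^ 2 := by
      unfold eigenvalue; ring
    have he : ε ^ (3 - 2 * (T / S)) = ε ^ 3 * ε ^ (-(2 * (T / S))) := by
      rw [sub_eq_add_neg, Real.rpow_add hε0]
      norm_cast
    rw [hk, hexp, he]
    field_simp
    ring
  rw [h3, Real.mul_rpow (by norm_num) (by positivity), ← Real.rpow_mul hε0.le]
  ring_nf

end HeatObs

theorem theorem1 (x₀ : ℝ) (hx₀ : x₀ ∈ Set.Ioo (0 : ℝ) 1) (T : ℝ) (hT : 0 < T) :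
    (HeatObs.minimalTime x₀ < ENNReal.ofReal T →
      ∃ C₁ C₂ : ℝ, 0 < C₁ ∧ 0 < C₂ ∧
        ∀ ε : ℝ, 0 < ε → Set.Ioo (x₀ - ε) (x₀ + ε) ⊆ Set.Ioo (0 : ℝ) 1 →
          ENNReal.ofReal (C₁ * ε ^ (1 / 2 : ℝ)) ≤
              HeatObs.obsConst T (Set.Ioo (x₀ - ε) (x₀ + ε)) ∧
            HeatObs.obsConst T (Set.Ioo (x₀ - ε) (x₀ + ε)) ≤
              ENNReal.ofReal (C₂ * ε ^ (1 / 2 : ℝ))) ∧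
    (ENNReal.ofReal T < HeatObs.minimalTime x₀ →
      ∃ (ε : ℕ → ℝ) (C₁ C₂ : ℝ),
        (∀ k, 0 < ε k ∧ Set.Ioo (x₀ - ε k) (x₀ + ε k) ⊆ Set.Ioo (0 : ℝ) 1) ∧
        Tendsto ε atTop (𝓝 0) ∧ 0 < C₁ ∧ 1 / 2 < C₂ ∧
        ∀ k, HeatObs.obsConst T (Set.Ioo (x₀ - ε k) (x₀ + ε k)) ≤
          ENNReal.ofReal (C₁ * ε k ^ C₂)) := by
  constructor
  · intro hmin
    simp only [HeatObs.minimalTime, iInf_lt_iff] at hmin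
    obtain ⟨T', hT', hobs, hlt⟩ := hmin
    obtain ⟨C, hC, hlow⟩ := hobs.exists_le_obsConst hT'
      ((ENNReal.ofReal_lt_ofReal_iff hT).1 hlt).le
    have hlam := HeatObs.eigenvalue_pos 0
    refine ⟨C, (2 * (Real.exp (2 * HeatObs.eigenvalue 0 * T) / HeatObs.eigenvalue 0)) ^ (1 / 2 : ℝ),
      hC, by positivity, fun ε hε hsub => ⟨hlow ε hε hsub, ?_⟩⟩
    -- The first mode, bounded by one, gives a squared observation proportional to the length `2ε`.
    refine (HeatObs.obsConst_Ioo_le 0 hT (by linarith)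
      fun x _ => HeatObs.abs_sineMode_le_one 0 x).trans (le_of_eq ?_)
    rw [← Real.mul_rpow (by positivity) hε.le]
    ring_nf
  · intro hmin
    obtain ⟨T', hT'0, hTT', hT'min⟩ := ENNReal.lt_iff_exists_real_btwn.1 hmin
    have hlt : T < T' := (ENNReal.ofReal_lt_ofReal_iff'.1 hTT').1
    have hnot : ¬ HeatObs.PointwiseObservable T' x₀ := fun hobs =>
      absurd hT'min (not_lt.2 (iInf₂_le_of_le T' (hT.trans hlt) (iInf_le _ hobs)))
    -- Strictly between: `S < T'` is needed to get small eigenfunctions from non-observability in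
    -- time `T'`, and `T < S` to bring the exponent above `1/2`.
    set S := (T + T') / 2 with hS
    have hTS : T < S := by rw [hS]; linarith
    have hS0 : 0 < S := hT.trans hTS
    have hlim : Tendsto (fun n => Real.exp (-(HeatObs.eigenvalue n * S))) atTop (𝓝 0) := by
      simpa only [mul_comm] using
        (HeatObs.summable_exp_neg_mul_eigenvalue hS0).tendsto_atTop_zero
    have hev : ∀ᶠ n in atTop, Real.exp (-(HeatObs.eigenvalue n * S)) < min x₀ (1 - x₀) :=
      hlim.eventually_lt_const (lt_min hx₀.1 (by linarith [hx₀.2]))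
    have hfreq := (HeatObs.frequently_abs_sineMode_le hx₀ hS0.le (by rw [hS]; linarith)
      hnot).and_eventually hev
    obtain ⟨φ, hφ, hφP⟩ := extraction_of_frequently_atTop hfreq
    refine ⟨fun k => Real.exp (-(HeatObs.eigenvalue (φ k) * S)), 8 ^ (1 / 2 : ℝ), 3 / 2 - T / S,
      fun k => ⟨Real.exp_pos _, ?_⟩, hlim.comp hφ.tendsto_atTop, by positivity, ?_, fun k => ?_⟩
    · rw [HeatObs.Ioo_subset_unit_iff (Real.exp_pos _)]
      have := lt_min_iff.1 (hφP k).2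
      exact ⟨this.1.le, this.2.le⟩
    · have : T / S < 1 := (div_lt_one hS0).2 hTS
      linarith
    · exact HeatObs.obsConst_le_of_abs_sineMode_le hT hTS rfl (hφP k).1
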